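/- **Setting (Matroid Blocking Bandits).** There are $k$ arms $\mathcal{A}=\{1,\dots,k\}$, a matroid $\mathcal{M}=(\mathcal{A},\mathcal{I})$ of rank $\mathrm{rk}(\mathcal{M})$, and delays $d_i\in\{1,2,\dots\}$ with $d_{\max}=\max_i d_i$. The reward vectors $(X_{i,t})_{i\in\mathcal{A}}\in[0,1]^k$, $t=1,2,\dots$, are i.i.d. over the rounds $t$ (the law of a single vector is arbitrary; in particular the arms may be independent). At each round $t$ the player, using only her private randomness (independent of all rewards) and the past observations, plays a set $\mathcal{A}_t\in\mathcal{I}$ such that no $i\in\mathcal{A}_t$ was played in the previous $d_i-1$ rounds; she then observes $X_{i,t}$ for $i\in\mathcal{A}_t$ and collects $\sum_{i\in\mathcal{A}_t}X_{i,t}$. Let $\mathrm{OPT}(T)$ be the supremum of the expected total reward over $T$ rounds over all such policies, which may be adaptive and randomized and may depend on the law of the rewards and on $T$. **Algorithm (interleaved-ucb).** Without knowledge of the law of the rewards or of $T$: draw independent offsets $r_i\sim U[0,1]$, $i\in\mathcal{A}$. At round $t=1,2,\dots$ let $\mathcal{G}_t$ be the set of arms $i$ for which the interval $\left[\frac{t}{d_i}+r_i,\frac{t+1}{d_i}+r_i\right)$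 contains an integer. For each arm let $T_i(t)$ be the number of times it was played before round $t$, let $\hat\mu_{i,T_i(t)}$ be the average of the observed rewards, and let $\bar\mu_{i,t}=\hat\mu_{i,T_i(t)}+\sqrt{2\ln t/T_i(t)}$ be its UCB index, with $\bar\mu_{i,t}=+\infty$ if $T_i(t)=0$. Go through the arms of $\mathcal{G}_t$ in non-increasing order of $\bar\mu_{i,t}$ (ties are ordered by any rule that depends only on the sets played so far), adding each arm that keeps the chosen set independent, and play the resulting set. **Theorem.** Interleaved-ucb always plays independent sets of available arms, and there is an absolute constant $C>0$ such that, for all instances, all tie-breaking rules and all $T$, its expected reward over $T$ rounds, $\mathrm{Rew}^{IB}(T)$, satisfies $$\mathrm{Rew}^{IB}(T)\ \ge\ \left(1-\frac1e\right)\mathrm{OPT}(T)-C\left(k\sqrt{T\ln T}+k^2+d_{\max}\,\mathrm{rk}(\mathcal{M})\right).$$ -/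

import Mathlib

open MeasureTheory

namespace MatroidBlockingBandits

/-- What the player knows about a past round: the set of arms played, and the observed rewards.
Only the rewards of the played arms are observed (semi-bandit feedback); the other entries are
set to `0`. -/
abbrev Obs (k : ℕ) : Type := Finset (Fin k) × (Fin k → ℝ)

/-- The history of play, most recent round first. At round `t = 1, 2, …` it has length `t - 1`. -/
abbrev History (k : ℕ) : Type := List (Obs k)

/-- A (possibly randomized) policy: from its private random seed and the history, it determines
the set of arms to be played in the next round. -/
abbrev Policy (k : ℕ) (S : Type) : Type := S → History k → Finset (Fin k)

/-- The history after `n` rounds when the policy `π` with seed `s` faces the reward table `X`;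
`X n i` is the reward of arm `i` at round `n + 1`. -/
def history {k : ℕ} {S : Type} (π : Policy k S) (s : S) (X : ℕ → Fin k → ℝ) : ℕ → History k
  | 0 => []
  | n + 1 =>
    (π s (history π s X n), fun i => if i ∈ π s (history π s X n) then X n i else 0) ::
      history π s X n

/-- The set of arms that the policy plays at round `n + 1`. -/
def play {k : ℕ} {S : Type} (π : Policy k S) (s : S) (X : ℕ → Fin k → ℝ) (n : ℕ) :
    Finset (Fin k) :=
  π s (history π s X n)

/-- A policy is admissible if the sets it plays are random variables, are independent in the
matroid, and never contain a blocked arm: consecutive plays of arm `i` are at least `d i` rounds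
apart. -/
structure IsAdmissible {k : ℕ} {S : Type} [MeasurableSpace S] (M : Matroid (Fin k))
    (d : Fin k → ℕ) (π : Policy k S) : Prop where
  measurable : ∀ (n : ℕ) (A : Finset (Fin k)),
    MeasurableSet {ω : S × (ℕ → Fin k → ℝ) | play π ω.1 ω.2 n = A}
  indep : ∀ (s : S) (X : ℕ → Fin k → ℝ) (n : ℕ), M.Indep (play π s X n : Set (Fin k))
  available : ∀ (s : S) (X : ℕ → Fin k → ℝ) (m n : ℕ), m < n →
    ∀ i ∈ play π s X n, i ∈ play π s X m → m + d i ≤ n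

/-- The reward collected in the rounds `1, …, T`. -/
def totalReward {k : ℕ} {S : Type} (π : Policy k S) (s : S) (X : ℕ → Fin k → ℝ) (T : ℕ) : ℝ :=
  ∑ n ∈ Finset.range T, ∑ i ∈ play π s X n, X n i

/-- The expected reward over `T` rounds of a policy with seed law `ρ`: the reward vectors of the
rounds are i.i.d. with law `ν`, and independent of the seed. -/
noncomputable def expectedReward {k : ℕ} {S : Type} [MeasurableSpace S] (ρ : Measure S)
    (ν : Measure (Fin k → ℝ)) [IsProbabilityMeasure ν] (π : Policy k S) (T : ℕ) : ℝ :=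
  ∫ ω, totalReward π ω.1 ω.2 T ∂(ρ.prod (Measure.infinitePi (fun _ : ℕ => ν)))

/-- `OPT(T)`: the supremum of the expected rewards over `T` rounds of all admissible policies.
The policies are adaptive, may be randomized, and may depend on the reward law and on `T`. -/
noncomputable def OPT {k : ℕ} (M : Matroid (Fin k)) (d : Fin k → ℕ) (ν : Measure (Fin k → ℝ))
    [IsProbabilityMeasure ν] (T : ℕ) : ℝ :=
  sSup {x : ℝ | ∃ (S : Type) (_ : MeasurableSpace S) (ρ : Measure S) (_ : IsProbabilityMeasure ρ)
    (π : Policy k S), IsAdmissible M d π ∧ x = expectedReward ρ ν π T}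

/-- The number of past rounds in which arm `i` was played. -/
def pulls {k : ℕ} (h : History k) (i : Fin k) : ℕ :=
  (h.filter (fun o => i ∈ o.1)).length

/-- The average of the rewards observed from arm `i`. -/
noncomputable def empMean {k : ℕ} (h : History k) (i : Fin k) : ℝ :=
  ((h.filter (fun o => i ∈ o.1)).map (fun o => o.2 i)).sum / pulls h i

/-- The UCB index of arm `i` at round `t = h.length + 1`; it is `+∞` for an arm without samples. -/
noncomputable def ucbIndex {k : ℕ} (h : History k) (i : Fin k) : EReal :=
  if pulls h i = 0 then ⊤
  else ((empMean h i + Real.sqrt (2 * Real.log ((h.length + 1 : ℕ) : ℝ) / pulls h i) : ℝ) : EReal)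

open Classical in
/-- The arms sampled at round `t` when the offsets are `r`: those `i` for which the interval
`[t / d i + r i, (t + 1) / d i + r i)` contains an integer. -/
noncomputable def sampled {k : ℕ} (d : Fin k → ℕ) (r : Fin k → ℝ) (t : ℕ) : Finset (Fin k) :=
  Finset.univ.filter (fun i => ∃ z : ℤ,
    (t : ℝ) * (1 / (d i : ℝ)) + r i ≤ (z : ℝ) ∧ (z : ℝ) < ((t : ℝ) + 1) * (1 / (d i : ℝ)) + r i)

open Classical in
/-- The greedy algorithm: go through the arms in the order of the list, and add each arm that
keeps the set independent. -/
noncomputable def greedy {k : ℕ} (M : Matroid (Fin k)) (l : List (Fin k)) : Finset (Fin k) :=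
  l.foldl (fun A i => if M.Indep ((insert i A : Finset (Fin k)) : Set (Fin k))
    then insert i A else A) ∅

open Classical in
/-- The algorithm interleaved-ucb. Its seed is the vector `r` of offsets. At each round it runs the
greedy algorithm on the sampled arms in non-increasing order of their UCB indices. Arms of equal
index are ordered by the rule `tie`, which may depend on the sets played so far (the insertion sort
is stable). The algorithm uses neither the reward law nor the time horizon. -/
noncomputable def interleavedUCB {k : ℕ} (M : Matroid (Fin k)) (d : Fin k → ℕ)
    (tie : List (Finset (Fin k)) → Equiv.Perm (Fin k)) : Policy k (Fin k → ℝ) :=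
  fun r h => greedy M
    (((List.ofFn (tie (h.map Prod.fst))).filter (fun i => i ∈ sampled d r (h.length + 1))).insertionSort
      (fun i j => ucbIndex h j ≤ ucbIndex h i))

/-- The law of the offsets: independent and uniform on `[0, 1]`. -/
noncomputable def offsetLaw (k : ℕ) : Measure (Fin k → ℝ) :=
  Measure.pi (fun _ : Fin k => volume.restrict (Set.Icc (0 : ℝ) 1))

end MatroidBlockingBandits

/-! Both rewards are compared with `T * F(1/d)`, where `F` is the multilinear extension of the
weighted rank function `f` of the mean rewards (`weightedRank`, `multilinearExt`).

Upper bound for any admissible policy (`sum_means_le`, a pathwise statement): blocking limits arm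
`i` to `T / d i + 1` plays. Submodularity of `f` then bounds the collected means by `T * (f R + ∑ (1
/ d i) * (f (insert i R) - f R)) + k`, for every reference set `R`. The correlation gap
`multilinearExt_ge` says that `F(1/d)` is at least `1 - 1/e` times any number lying below all the
expressions `f R + ∑ (1 / d i) * (f (insert i R) - f R)`.

Lower bound for the algorithm: at each single round the sampled set contains each arm independently
with probability `1 / d i`, so its expected weighted rank is exactly `F(1/d)`. Sampled sets of
different rounds are correlated, but linearity of expectation needs only one-round laws. When the
confidence bounds hold, greedy by UCB index loses at most the confidence widths of the arms actually
played (`weightedRank_sampled_le_of_notMem`). These widths sum to `O(√(T ln T))` per arm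
(`sum_armRegret_le'`), and the failure probabilities are summable (`measure_deviationEvent_le`).

Adaptivity is handled by resampling the rewards of one round: the set played at a round depends only
on the seed and earlier rewards, so a fresh copy of that round's rewards changes neither the set nor
the joint law. This yields `expectedReward_eq` and the exponential supermartingale bound
`lintegral_exp_deviation_le`. -/

namespace MatroidBlockingBandits

/-! ### Ranks of finite sets and the greedy algorithm -/

/-- The rank of a finite set, as a natural number. -/
noncomputable def finRank {k : ℕ} (M : Matroid (Fin k)) (S : Finset (Fin k)) : ℕ :=
  (M.eRk (S : Set (Fin k))).toNat

section Rank

variable {k : ℕ} {M : Matroid (Fin k)}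

lemma coe_finRank (S : Finset (Fin k)) : (finRank M S : ℕ∞) = M.eRk (S : Set (Fin k)) := by
  refine ENat.natCast_toNat ?_
  exact ((M.eRk_le_encard _).trans_lt S.finite_toSet.encard_lt_top).ne

lemma finRank_mono {S R : Finset (Fin k)} (h : S ⊆ R) : finRank M S ≤ finRank M R := by
  have := M.eRk_mono (Finset.coe_subset.2 h)
  rw [← coe_finRank, ← coe_finRank] at this
  exact_mod_cast this

lemma finRank_empty : finRank M ∅ = 0 := by simp [finRank]

lemma finRank_insert_le (i : Fin k) (S : Finset (Fin k)) :
    finRank M (insert i S) ≤ finRank M S + 1 := by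
  have := M.eRk_insert_le_add_one i (S : Set (Fin k))
  rw [← Finset.coe_insert, ← coe_finRank, ← coe_finRank] at this
  exact_mod_cast this

lemma finRank_inter_add_union_le (S R : Finset (Fin k)) :
    finRank M (S ∩ R) + finRank M (S ∪ R) ≤ finRank M S + finRank M R := by
  have := M.eRk_submod (S : Set (Fin k)) R
  rw [← Finset.coe_inter, ← Finset.coe_union, ← coe_finRank, ← coe_finRank, ← coe_finRank,
    ← coe_finRank] at this
  exact_mod_cast this

lemma finRank_of_indep {S : Finset (Fin k)} (h : M.Indep S) : finRank M S = S.card := by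
  have := h.eRk_eq_encard
  rw [← coe_finRank, Set.encard_coe_eq_coe_finsetCard] at this
  exact_mod_cast this

lemma finRank_of_isBasis {S R : Finset (Fin k)} (h : M.IsBasis S R) : finRank M R = S.card := by
  have := h.eRk_eq_encard
  rw [← coe_finRank, Set.encard_coe_eq_coe_finsetCard] at this
  exact_mod_cast this

/-- Submodularity: when the elements of `A` are added one by one, each marginal gain is at most its
gain over `R` alone. -/
lemma finRank_union_le_sum_marginals (R A : Finset (Fin k)) :
    (finRank M (A ∪ R) : ℝ) ≤
      finRank M R + ∑ i ∈ A, ((finRank M (insert i R) : ℝ) - finRank M R) := by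
  induction A using Finset.induction_on with
  | empty => simp
  | insert a A ha ih =>
    rw [Finset.sum_insert ha]
    have h := finRank_inter_add_union_le (M := M) (A ∪ R) (insert a R)
    have h1 : finRank M R ≤ finRank M ((A ∪ R) ∩ insert a R) :=
      finRank_mono (by intro x hx; simp [hx])
    have h2 : (A ∪ R) ∪ insert a R = insert a A ∪ R := by ext x; simp
    rw [h2] at h
    have h3 : finRank M R + finRank M (insert a A ∪ R) ≤
      finRank M (A ∪ R) + finRank M (insert a R) := by omega
    have h4 : (finRank M R : ℝ) + finRank M (insert a A ∪ R) ≤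
      finRank M (A ∪ R) + finRank M (insert a R) := by exact_mod_cast h3
    linarith

lemma card_le_sum_marginals {A : Finset (Fin k)} (hA : M.Indep A) (R : Finset (Fin k)) :
    (A.card : ℝ) ≤ finRank M R + ∑ i ∈ A, ((finRank M (insert i R) : ℝ) - finRank M R) := by
  refine le_trans ?_ (finRank_union_le_sum_marginals R A)
  rw [← finRank_of_indep hA]
  exact_mod_cast finRank_mono Finset.subset_union_left

end Rank

section Greedy

variable {k : ℕ} (M : Matroid (Fin k))

open Classical in
lemma greedy_concat (l : List (Fin k)) (x : Fin k) :
    greedy M (l ++ [x]) =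
      if M.Indep ((insert x (greedy M l) : Finset (Fin k)) : Set (Fin k)) then
        insert x (greedy M l) else greedy M l := by
  simp [greedy, List.foldl_append]

/-- A rejected element lies in the closure of the set chosen so far, so maximality persists. No
ordering of `l` is needed. -/
lemma greedy_isBasis (hM : M.E = Set.univ) (l : List (Fin k)) :
    M.IsBasis (greedy M l : Set (Fin k)) {i | i ∈ l} := by
  classical
  induction l using List.reverseRecOn with
  | nil => simp [greedy]
  | append_singleton l x ih =>
    have hset : {i | i ∈ l ++ [x]} = insert x {i | i ∈ l} := by ext; simp; tauto
    rw [greedy_concat, hset]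
    split_ifs with h
    · rw [Finset.coe_insert] at h ⊢
      exact ih.insert_isBasis_insert h
    · rw [Finset.coe_insert] at h
      have hx : x ∈ M.closure (greedy M l : Set (Fin k)) := by
        by_contra hx
        exact h (ih.indep.insert_indep_iff.2 (Or.inl ⟨by simp [hM], hx⟩))
      refine ih.indep.isBasis_of_subset_of_subset_closure
        (ih.subset.trans (Set.subset_insert _ _)) (Set.insert_subset hx ih.subset_closure)

lemma greedy_subset (hM : M.E = Set.univ) (l : List (Fin k)) : greedy M l ⊆ l.toFinset := by
  intro i hi
  simpa using (greedy_isBasis M hM l).subset hi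

/-- In a sorted list each superlevel set is a prefix, and greedy on a prefix yields a basis of it.
Hence one greedy set is optimal at all thresholds simultaneously. -/
lemma finRank_filter_lt_eq (hM : M.E = Set.univ) (w : Fin k → ℝ) (θ : ℝ) (l : List (Fin k))
    (hl : l.Pairwise (fun i j => w j ≤ w i)) :
    finRank M (l.toFinset.filter (fun i => θ < w i)) =
      ((greedy M l).filter (fun i => θ < w i)).card := by
  classical
  induction l using List.reverseRecOn with
  | nil => simp [greedy, finRank_empty]
  | append_singleton l x ih =>
    rw [List.pairwise_append] at hl
    by_cases hx : θ < w x
    · have hall : ∀ i ∈ l ++ [x], θ < w i := by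
        intro i hi
        rcases List.mem_append.1 hi with h | h
        · exact hx.trans_le (hl.2.2 i h x (by simp))
        · simp only [List.mem_singleton] at h; rwa [h]
      rw [Finset.filter_true_of_mem (fun i hi => hall i (List.mem_toFinset.1 hi)),
        Finset.filter_true_of_mem
          (fun i hi => hall i (List.mem_toFinset.1 (greedy_subset M hM _ hi)))]
      refine finRank_of_isBasis ?_
      convert greedy_isBasis M hM (l ++ [x]) using 1
      ext; simp [or_comm]
    · have h1 : (l ++ [x]).toFinset.filter (fun i => θ < w i) =
          l.toFinset.filter (fun i => θ < w i) := by
        ext i; simp only [List.toFinset_append, Finset.mem_filter, Finset.mem_union,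
          List.mem_toFinset, List.mem_singleton]
        constructor
        · rintro ⟨h | rfl, h'⟩
          · exact ⟨h, h'⟩
          · exact absurd h' hx
        · rintro ⟨h, h'⟩; exact ⟨Or.inl h, h'⟩
      rw [h1, ih hl.1, greedy_concat]
      split_ifs with h
      · rw [Finset.filter_insert, if_neg hx]
      · rfl

end Greedy

/-! ### The weighted rank function -/

section WeightedRank

variable {k : ℕ} (M : Matroid (Fin k))

/-- The largest weight of an independent subset of `S`, for weights `μ` in `[0, 1]`, written as an
integral of the ranks of the superlevel sets of `μ`. -/
noncomputable def weightedRank (μ : Fin k → ℝ) (S : Finset (Fin k)) : ℝ :=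
  ∫ θ in (0 : ℝ)..1, (finRank M (S.filter (fun i => θ < μ i)) : ℝ)

lemma filter_lt_antitone (μ : Fin k → ℝ) (S : Finset (Fin k)) {θ η : ℝ} (h : θ ≤ η) :
    S.filter (fun i => η < μ i) ⊆ S.filter (fun i => θ < μ i) := by
  intro i hi
  rw [Finset.mem_filter] at hi ⊢
  exact ⟨hi.1, h.trans_lt hi.2⟩

lemma intervalIntegrable_finRank (μ : Fin k → ℝ) (S : Finset (Fin k)) :
    IntervalIntegrable (fun θ => (finRank M (S.filter (fun i => θ < μ i)) : ℝ)) volume 0 1 := by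
  refine Antitone.intervalIntegrable ?_
  intro θ η h
  exact Nat.cast_le.2 <| finRank_mono (filter_lt_antitone μ S h)

lemma intervalIntegrable_card_filter (μ : Fin k → ℝ) (S : Finset (Fin k)) :
    IntervalIntegrable (fun θ => ((S.filter (fun i => θ < μ i)).card : ℝ)) volume 0 1 := by
  refine Antitone.intervalIntegrable ?_
  intro θ η h
  exact Nat.cast_le.2 <| Finset.card_le_card (filter_lt_antitone μ S h)

lemma integral_indicator_lt {a : ℝ} (h0 : 0 ≤ a) (h1 : a ≤ 1) :
    ∫ θ in (0 : ℝ)..1, (if θ < a then (1 : ℝ) else 0) = a := by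
  have h : (fun θ => if θ < a then (1 : ℝ) else 0) = (Set.Iio a).indicator (fun _ => (1 : ℝ)) := by
    ext θ; simp [Set.indicator_apply]
  rw [h, intervalIntegral.integral_of_le zero_le_one, integral_indicator measurableSet_Iio,
    Measure.restrict_restrict measurableSet_Iio]
  have h2 : Set.Iio a ∩ Set.Ioc 0 1 = Set.Ioo 0 a := by
    ext x; simp only [Set.mem_inter_iff, Set.mem_Iio, Set.mem_Ioc, Set.mem_Ioo]
    constructor
    · rintro ⟨h1, h2, h3⟩; exact ⟨h2, h1⟩
    · rintro ⟨h2, h3⟩; exact ⟨h3, h2, by linarith⟩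
  rw [h2]
  simp [h0]

lemma sum_eq_integral_card {μ : Fin k → ℝ} (hμ : ∀ i, μ i ∈ Set.Icc (0 : ℝ) 1)
    (S : Finset (Fin k)) :
    ∑ i ∈ S, μ i = ∫ θ in (0 : ℝ)..1, ((S.filter (fun i => θ < μ i)).card : ℝ) := by
  have h : ∀ θ : ℝ, ((S.filter (fun i => θ < μ i)).card : ℝ) =
      ∑ i ∈ S, if θ < μ i then (1 : ℝ) else 0 := by
    intro θ; simp
  simp_rw [h]
  rw [intervalIntegral.integral_finsetSum]
  · exact Finset.sum_congr rfl fun i _ => (integral_indicator_lt (hμ i).1 (hμ i).2).symm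
  · intro i _
    refine Antitone.intervalIntegrable ?_
    intro θ η h
    dsimp only
    split_ifs with h1 h2
    · exact le_rfl
    · exact absurd (h.trans_lt h1) h2
    · exact zero_le_one
    · exact le_rfl

lemma weightedRank_mono (μ : Fin k → ℝ) {S R : Finset (Fin k)} (h : S ⊆ R) :
    weightedRank M μ S ≤ weightedRank M μ R := by
  refine intervalIntegral.integral_mono zero_le_one (intervalIntegrable_finRank M μ S)
    (intervalIntegrable_finRank M μ R) ?_
  intro θ
  exact Nat.cast_le.2 <| finRank_mono (Finset.filter_subset_filter _ h)

lemma weightedRank_empty (μ : Fin k → ℝ) : weightedRank M μ ∅ = 0 := by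
  simp [weightedRank, finRank_empty]

lemma weightedRank_insert_le (μ : Fin k → ℝ) (i : Fin k) (S : Finset (Fin k)) :
    weightedRank M μ (insert i S) ≤ weightedRank M μ S + 1 := by
  have h1 : ∫ θ in (0 : ℝ)..1, ((finRank M (S.filter (fun i => θ < μ i)) : ℝ) + 1) =
      weightedRank M μ S + 1 := by
    rw [intervalIntegral.integral_add (intervalIntegrable_finRank M μ S) (by simp)]
    simp [weightedRank]
  rw [← h1]
  refine intervalIntegral.integral_mono zero_le_one (intervalIntegrable_finRank M μ _)
    ((intervalIntegrable_finRank M μ S).add (by simp)) ?_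
  intro θ
  dsimp only
  rw [Finset.filter_insert]
  split_ifs
  · exact_mod_cast finRank_insert_le i _
  · linarith

lemma weightedRank_le_card (μ : Fin k → ℝ) (S : Finset (Fin k)) :
    weightedRank M μ S ≤ S.card := by
  induction S using Finset.induction_on with
  | empty => simp [weightedRank_empty]
  | insert a S ha ih =>
    rw [Finset.card_insert_of_notMem ha]
    push_cast
    linarith [weightedRank_insert_le M μ a S]

/-- The layer-cake form reduces this to `card_le_sum_marginals` at each threshold `θ`; arms with `μ
i ≤ θ` have zero marginal there. -/
lemma sum_le_weightedRank_add {μ : Fin k → ℝ} (hμ : ∀ i, μ i ∈ Set.Icc (0 : ℝ) 1)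
    {A : Finset (Fin k)} (hA : M.Indep A) (R : Finset (Fin k)) :
    ∑ i ∈ A, μ i ≤ weightedRank M μ R +
      ∑ i ∈ A, (weightedRank M μ (insert i R) - weightedRank M μ R) := by
  have hint : ∀ i ∈ A, IntervalIntegrable (fun θ =>
      (finRank M ((insert i R).filter (fun i => θ < μ i)) : ℝ) -
        finRank M (R.filter (fun i => θ < μ i))) volume 0 1 := fun i _ =>
    (intervalIntegrable_finRank M μ _).sub (intervalIntegrable_finRank M μ R)
  have hsum : IntervalIntegrable (fun θ => ∑ i ∈ A,
      ((finRank M ((insert i R).filter (fun i => θ < μ i)) : ℝ) -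
        finRank M (R.filter (fun i => θ < μ i)))) volume 0 1 := by
    have := IntervalIntegrable.sum A hint
    refine this.congr ?_
    intro θ _
    simp
  have h1 : ∑ i ∈ A, (weightedRank M μ (insert i R) - weightedRank M μ R) =
      ∫ θ in (0 : ℝ)..1, ∑ i ∈ A, ((finRank M ((insert i R).filter (fun i => θ < μ i)) : ℝ) -
        finRank M (R.filter (fun i => θ < μ i))) := by
    rw [intervalIntegral.integral_finsetSum hint]
    refine Finset.sum_congr rfl fun i _ => ?_
    rw [intervalIntegral.integral_sub (intervalIntegrable_finRank M μ _)
      (intervalIntegrable_finRank M μ R)]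
    rfl
  rw [h1, sum_eq_integral_card hμ]
  unfold weightedRank
  rw [← intervalIntegral.integral_add (intervalIntegrable_finRank M μ R) hsum]
  refine intervalIntegral.integral_mono zero_le_one (intervalIntegrable_card_filter μ A)
    ((intervalIntegrable_finRank M μ R).add hsum) ?_
  intro θ
  have hA' : M.Indep (A.filter (fun i => θ < μ i) : Finset (Fin k)) :=
    hA.subset (by exact_mod_cast Finset.filter_subset _ _)
  refine (card_le_sum_marginals hA' (R.filter (fun i => θ < μ i))).trans ?_
  dsimp only
  gcongr
  rw [Finset.sum_filter]
  refine Finset.sum_le_sum fun i _ => ?_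
  rw [Finset.filter_insert]
  split_ifs
  · exact le_rfl
  · simp

/-- Optimism: greedy is optimal for the weights `w` that order the list, and raising `μ` to `w` only
enlarges the superlevel sets. -/
lemma weightedRank_le_sum_greedy (hM : M.E = Set.univ) {μ w : Fin k → ℝ}
    (hw : ∀ i, w i ∈ Set.Icc (0 : ℝ) 1) (hμw : ∀ i, μ i ≤ w i) (l : List (Fin k))
    (hl : l.Pairwise (fun i j => w j ≤ w i)) :
    weightedRank M μ l.toFinset ≤ ∑ i ∈ greedy M l, w i := by
  rw [sum_eq_integral_card hw]
  refine intervalIntegral.integral_mono zero_le_one (intervalIntegrable_finRank M μ _)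
    (intervalIntegrable_card_filter w _) ?_
  intro θ
  dsimp only
  rw [← finRank_filter_lt_eq M hM w θ l hl]
  refine Nat.cast_le.2 (finRank_mono ?_)
  intro i hi
  rw [Finset.mem_filter] at hi ⊢
  exact ⟨hi.1, hi.2.trans_le (hμw i)⟩

end WeightedRank

/-! ### The correlation gap -/

section CorrelationGap

variable {k : ℕ}

/-- The probability that a random set, which contains each `i` independently with probability
`p i`, equals `S`. -/
noncomputable def bernoulliWeight (p : Fin k → ℝ) (S : Finset (Fin k)) : ℝ :=
  ∏ i, if i ∈ S then p i else 1 - p i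

/-- The multilinear extension of a set function. -/
noncomputable def multilinearExt (f : Finset (Fin k) → ℝ) (p : Fin k → ℝ) : ℝ :=
  ∑ S, bernoulliWeight p S * f S

lemma bernoulliWeight_nonneg {p : Fin k → ℝ} (hp : ∀ i, p i ∈ Set.Icc (0 : ℝ) 1)
    (S : Finset (Fin k)) : 0 ≤ bernoulliWeight p S := by
  refine Finset.prod_nonneg fun i _ => ?_
  split_ifs
  · exact (hp i).1
  · linarith [(hp i).2]

lemma sum_bernoulliWeight (p : Fin k → ℝ) : ∑ S, bernoulliWeight p S = 1 := by
  have h := Finset.prod_add p (fun i => 1 - p i) Finset.univ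
  simp only [add_sub_cancel, Finset.prod_const_one] at h
  rw [h, Finset.powerset_univ]
  refine Finset.sum_congr rfl fun S _ => ?_
  rw [bernoulliWeight, Finset.prod_ite]
  congr 2 <;> ext <;> simp

lemma bernoulliWeight_zero (S : Finset (Fin k)) :
    bernoulliWeight 0 S = if S = ∅ then 1 else 0 := by
  split_ifs with h
  · simp [bernoulliWeight, h]
  · obtain ⟨i, hi⟩ := Finset.nonempty_iff_ne_empty.2 h
    exact Finset.prod_eq_zero (Finset.mem_univ i) (by simp [hi])

lemma sum_finset_eq_add_insert (i : Fin k) (g : Finset (Fin k) → ℝ) :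
    ∑ S, g S = ∑ S ∈ (Finset.univ.erase i).powerset, (g S + g (insert i S)) := by
  rw [Finset.sum_add_distrib, ← Finset.sum_powerset_insert (Finset.notMem_erase i _),
    Finset.insert_erase (Finset.mem_univ i), Finset.powerset_univ]

/-- The left side is the partial derivative of the multilinear extension in `p i`. Pairing `S` with
`insert i S`, the marginal on the right is the same for both, and their factors at `i` add up to
one. -/
lemma sum_prod_erase_mul (p : Fin k → ℝ) (f : Finset (Fin k) → ℝ) (i : Fin k) :
    ∑ S, (∏ j ∈ Finset.univ.erase i, if j ∈ S then p j else 1 - p j) *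
        (if i ∈ S then f S else - f S) =
      ∑ S, bernoulliWeight p S * (f (insert i S) - f (S.erase i)) := by
  rw [sum_finset_eq_add_insert i, sum_finset_eq_add_insert i]
  refine Finset.sum_congr rfl fun S hS => ?_
  have hi : i ∉ S := fun h => by
    have := Finset.mem_powerset.1 hS h
    simp at this
  have hc : (∏ j ∈ Finset.univ.erase i, if j ∈ insert i S then p j else 1 - p j) =
      ∏ j ∈ Finset.univ.erase i, if j ∈ S then p j else 1 - p j := by
    refine Finset.prod_congr rfl fun j hj => ?_
    simp [(Finset.mem_erase.1 hj).1]
  have h1 : bernoulliWeight p S =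
      (1 - p i) * ∏ j ∈ Finset.univ.erase i, if j ∈ S then p j else 1 - p j := by
    rw [bernoulliWeight, ← Finset.mul_prod_erase _ _ (Finset.mem_univ i), if_neg hi]
  have h2 : bernoulliWeight p (insert i S) =
      p i * ∏ j ∈ Finset.univ.erase i, if j ∈ S then p j else 1 - p j := by
    rw [bernoulliWeight, ← Finset.mul_prod_erase _ _ (Finset.mem_univ i),
      if_pos (Finset.mem_insert_self i S), hc]
  rw [hc, h1, h2, if_neg hi, if_pos (Finset.mem_insert_self i S), Finset.insert_idem,
    Finset.erase_insert hi, Finset.erase_eq_of_notMem hi]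
  ring

lemma hasDerivAt_multilinearExt (f : Finset (Fin k) → ℝ) (p : Fin k → ℝ) (t : ℝ) :
    HasDerivAt (fun t : ℝ => multilinearExt f (t • p))
      (∑ i, p i * ∑ S, bernoulliWeight (t • p) S * (f (insert i S) - f (S.erase i))) t := by
  have hfac : ∀ (S : Finset (Fin k)) (i : Fin k), HasDerivAt
      (fun t : ℝ => if i ∈ S then (t • p) i else 1 - (t • p) i)
      (if i ∈ S then p i else - p i) t := by
    intro S i
    simp only [Pi.smul_apply, smul_eq_mul]
    split_ifs
    · simpa using (hasDerivAt_id t).mul_const (p i)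
    · simpa using ((hasDerivAt_id t).mul_const (p i)).const_sub 1
  have hw : ∀ S : Finset (Fin k), HasDerivAt (fun t : ℝ => bernoulliWeight (t • p) S * f S)
      ((∑ i, (∏ j ∈ Finset.univ.erase i, if j ∈ S then (t • p) j else 1 - (t • p) j) •
        (if i ∈ S then p i else - p i)) * f S) t := fun S =>
    (HasDerivAt.fun_finsetProd (u := Finset.univ) fun i _ => hfac S i).mul_const (f S)
  have h := HasDerivAt.fun_sum (u := Finset.univ) fun S _ => hw S
  unfold multilinearExt
  refine h.congr_deriv ?_
  simp_rw [← sum_prod_erase_mul, Finset.sum_mul, Finset.mul_sum]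
  rw [Finset.sum_comm]
  refine Finset.sum_congr rfl fun i _ => Finset.sum_congr rfl fun S _ => ?_
  rw [smul_eq_mul]
  split_ifs <;> ring

/-- The correlation gap: a lower bound on the multilinear extension of a monotone set function. -/
lemma multilinearExt_ge {f : Finset (Fin k) → ℝ} (hmono : ∀ S R, S ⊆ R → f S ≤ f R)
    (hempty : f ∅ = 0) {p : Fin k → ℝ} (hp : ∀ i, p i ∈ Set.Icc (0 : ℝ) 1) {V : ℝ}
    (hV : ∀ R, V ≤ f R + ∑ i, p i * (f (insert i R) - f R)) :
    (1 - 1 / Real.exp 1) * V ≤ multilinearExt f p := by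
  -- Average `hV` over the random set with marginals `t • p`; monotonicity lets `f (S.erase i)`
  -- replace `f S` in the marginals.
  have hderiv : ∀ t ∈ Set.Icc (0 : ℝ) 1, V - multilinearExt f (t • p) ≤
      ∑ i, p i * ∑ S, bernoulliWeight (t • p) S * (f (insert i S) - f (S.erase i)) := by
    intro t ht
    have hp' : ∀ i, (t • p) i ∈ Set.Icc (0 : ℝ) 1 := fun i =>
      ⟨mul_nonneg ht.1 (hp i).1, mul_le_one₀ ht.2 (hp i).1 (hp i).2⟩
    have h1 : V ≤ ∑ S, bernoulliWeight (t • p) S *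
        (f S + ∑ i, p i * (f (insert i S) - f S)) := by
      calc V = ∑ S, bernoulliWeight (t • p) S * V := by
            rw [← Finset.sum_mul, sum_bernoulliWeight, one_mul]
        _ ≤ _ := Finset.sum_le_sum fun S _ =>
            mul_le_mul_of_nonneg_left (hV S) (bernoulliWeight_nonneg hp' S)
    have h2 : ∑ S, bernoulliWeight (t • p) S * (f S + ∑ i, p i * (f (insert i S) - f S)) =
        multilinearExt f (t • p) +
          ∑ i, p i * ∑ S, bernoulliWeight (t • p) S * (f (insert i S) - f S) := by
      simp_rw [mul_add, Finset.sum_add_distrib, multilinearExt, Finset.mul_sum]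
      congr 1
      rw [Finset.sum_comm]
      exact Finset.sum_congr rfl fun i _ => Finset.sum_congr rfl fun S _ => by ring
    have h3 : ∑ i, p i * ∑ S, bernoulliWeight (t • p) S * (f (insert i S) - f S) ≤
        ∑ i, p i * ∑ S, bernoulliWeight (t • p) S * (f (insert i S) - f (S.erase i)) := by
      refine Finset.sum_le_sum fun i _ => mul_le_mul_of_nonneg_left
        (Finset.sum_le_sum fun S _ => mul_le_mul_of_nonneg_left ?_
          (bernoulliWeight_nonneg hp' S)) (hp i).1
      linarith [hmono _ _ (Finset.erase_subset i S)]
    linarith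
  have hd : ∀ t : ℝ, HasDerivAt (fun t => Real.exp t * (multilinearExt f (t • p) - V))
      (Real.exp t * (multilinearExt f (t • p) - V) + Real.exp t *
        ∑ i, p i * ∑ S, bernoulliWeight (t • p) S * (f (insert i S) - f (S.erase i))) t :=
    fun t => (Real.hasDerivAt_exp t).mul ((hasDerivAt_multilinearExt f p t).sub_const V)
  -- The differential inequality `F' ≥ V - F` integrated with the factor `exp t`; comparing the ends
  -- `0` and `1` produces `1 - 1/e`.
  have hm : MonotoneOn (fun t : ℝ => Real.exp t * (multilinearExt f (t • p) - V))
      (Set.Icc 0 1) := by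
    refine monotoneOn_of_deriv_nonneg (convex_Icc 0 1)
      (fun t _ => (hd t).continuousAt.continuousWithinAt)
      (fun t _ => (hd t).differentiableAt.differentiableWithinAt) ?_
    intro t ht
    rw [interior_Icc] at ht
    rw [(hd t).deriv, ← mul_add]
    refine mul_nonneg (Real.exp_pos t).le ?_
    linarith [hderiv t ⟨ht.1.le, ht.2.le⟩]
  have h01 := hm (Set.left_mem_Icc.2 zero_le_one) (Set.right_mem_Icc.2 zero_le_one) zero_le_one
  have h0 : multilinearExt f 0 = 0 := by
    simp [multilinearExt, bernoulliWeight_zero, hempty]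
  simp only [zero_smul, one_smul, Real.exp_zero, h0] at h01
  have he := Real.exp_pos 1
  have h2 : (-V) / Real.exp 1 ≤ multilinearExt f p - V := by
    rw [div_le_iff₀ he]; linarith
  have h3 : (1 - 1 / Real.exp 1) * V = V + (-V) / Real.exp 1 := by ring
  linarith

end CorrelationGap

/-! ### Upper bound on the means collected by any sequence of plays -/

section UpperBound

variable {k : ℕ}

/-- A set of naturals below `T` with gaps at least `d` has at most `T / d + 1` elements. -/
lemma card_le_of_gaps {d T : ℕ} (hd : 0 < d) (s : Finset ℕ) (hs : ∀ n ∈ s, n < T)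
    (hgap : ∀ m ∈ s, ∀ n ∈ s, m < n → m + d ≤ n) : (s.card : ℝ) ≤ T * (1 / (d : ℝ)) + 1 := by
  have h1 : s.card ≤ (Finset.range (T / d + 1)).card := by
    -- Each block of `d` consecutive rounds contains at most one element.
    refine Finset.card_le_card_of_injOn (fun n => n / d) ?_ ?_
    · intro n hn
      simp only [Finset.coe_range, Set.mem_Iio]
      exact Nat.lt_succ_of_le (Nat.div_le_div_right (hs n hn).le)
    · intro m hm n hn hmn
      dsimp only at hmn
      by_contra hne
      have key : ∀ a b : ℕ, a + d ≤ b → a / d < b / d := by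
        intro a b hab
        have := Nat.div_le_div_right (c := d) hab
        rw [Nat.add_div_right _ hd] at this
        omega
      rcases lt_or_gt_of_ne hne with h | h
      · exact absurd hmn (key m n (hgap m hm n hn h)).ne
      · exact absurd hmn (key n m (hgap n hn m hm h)).ne'
  rw [Finset.card_range] at h1
  have h2 : (s.card : ℝ) ≤ ((T / d : ℕ) : ℝ) + 1 := by exact_mod_cast h1
  have h3 : ((T / d : ℕ) : ℝ) ≤ (T : ℝ) / d := Nat.cast_div_le
  rw [mul_one_div]
  linarith

/-- After exchanging sums only the number of plays of each arm matters. The error `k` comes from the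
extra play in `card_le_of_gaps`, since each marginal lies in `[0, 1]`. -/
lemma sum_means_le {M : Matroid (Fin k)} {d : Fin k → ℕ} (hd : ∀ i, 0 < d i) {μ : Fin k → ℝ}
    (hμ : ∀ i, μ i ∈ Set.Icc (0 : ℝ) 1) (A : ℕ → Finset (Fin k)) (hA : ∀ n, M.Indep (A n))
    (hgap : ∀ m n, m < n → ∀ i ∈ A n, i ∈ A m → m + d i ≤ n) (T : ℕ) :
    (1 - 1 / Real.exp 1) * ∑ n ∈ Finset.range T, ∑ i ∈ A n, μ i ≤
      T * multilinearExt (weightedRank M μ) (fun i => 1 / (d i : ℝ)) + k := by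
  set f := weightedRank M μ
  have he : 0 ≤ 1 / Real.exp 1 := by positivity
  have he' : 1 / Real.exp 1 ≤ 1 := by
    rw [div_le_one (Real.exp_pos 1)]; exact Real.one_le_exp zero_le_one
  rcases Nat.eq_zero_or_pos T with rfl | hT
  · simp
  have hT' : (0 : ℝ) < T := by exact_mod_cast hT
  have hp : ∀ i, (1 / (d i : ℝ)) ∈ Set.Icc (0 : ℝ) 1 := by
    intro i
    have : (1 : ℝ) ≤ d i := by exact_mod_cast hd i
    exact ⟨by positivity, by rw [div_le_one (by linarith)]; exact this⟩
  have key : ∀ R, ∑ n ∈ Finset.range T, ∑ i ∈ A n, μ i - k ≤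
      T * (f R + ∑ i, (1 / (d i : ℝ)) * (f (insert i R) - f R)) := by
    intro R
    have h1 : ∑ n ∈ Finset.range T, ∑ i ∈ A n, μ i ≤
        ∑ n ∈ Finset.range T, (f R + ∑ i ∈ A n, (f (insert i R) - f R)) :=
      Finset.sum_le_sum fun n _ => sum_le_weightedRank_add M hμ (hA n) R
    have h2 : ∑ n ∈ Finset.range T, ∑ i ∈ A n, (f (insert i R) - f R) =
        ∑ i, (((Finset.range T).filter (fun n => i ∈ A n)).card : ℝ) *
          (f (insert i R) - f R) := by
      have : ∀ n, ∑ i ∈ A n, (f (insert i R) - f R) =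
          ∑ i, if i ∈ A n then (f (insert i R) - f R) else 0 := by
        intro n; rw [Finset.sum_ite_mem, Finset.univ_inter]
      simp_rw [this]
      rw [Finset.sum_comm]
      refine Finset.sum_congr rfl fun i _ => ?_
      rw [← Finset.sum_filter, Finset.sum_const, nsmul_eq_mul]
    have h3 : ∀ i, (((Finset.range T).filter (fun n => i ∈ A n)).card : ℝ) *
        (f (insert i R) - f R) ≤ T * ((1 / (d i : ℝ)) * (f (insert i R) - f R)) + 1 := by
      intro i
      have hc := card_le_of_gaps (hd i) ((Finset.range T).filter (fun n => i ∈ A n))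
        (fun n hn => by simpa using (Finset.mem_filter.1 hn).1)
        (fun m hm n hn hmn => hgap m n hmn i (Finset.mem_filter.1 hn).2 (Finset.mem_filter.1 hm).2)
      have h0 : 0 ≤ f (insert i R) - f R :=
        sub_nonneg.2 (weightedRank_mono M μ (Finset.subset_insert i R))
      have h1 : f (insert i R) - f R ≤ 1 := by
        linarith [weightedRank_insert_le M μ i R]
      nlinarith
    rw [Finset.sum_add_distrib, h2, Finset.sum_const, Finset.card_range, nsmul_eq_mul] at h1
    have h4 := Finset.sum_le_sum fun i (_ : i ∈ Finset.univ) => h3 i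
    rw [Finset.sum_add_distrib, ← Finset.mul_sum] at h4
    simp only [Finset.sum_const, Finset.card_univ, Fintype.card_fin, nsmul_eq_mul, mul_one] at h4
    linarith
  have h := multilinearExt_ge (f := f) (fun S R h => weightedRank_mono M μ h)
    (weightedRank_empty M μ) hp
    (V := (∑ n ∈ Finset.range T, ∑ i ∈ A n, μ i - k) / T) (fun R => by
      rw [div_le_iff₀ hT']; linarith [key R])
  have h5 : (1 - 1 / Real.exp 1) * (∑ n ∈ Finset.range T, ∑ i ∈ A n, μ i - k) ≤
      T * multilinearExt f (fun i => 1 / (d i : ℝ)) := by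
    have := mul_le_mul_of_nonneg_left h hT'.le
    refine le_trans (le_of_eq ?_) this
    field_simp
  have hk : (0 : ℝ) ≤ k := Nat.cast_nonneg k
  nlinarith

end UpperBound

/-! ### The random sampling times -/

section Sampling

variable {k : ℕ} {d : Fin k → ℕ}

/-- The offsets for which an arm of delay `d` is sampled at round `t`. -/
def offsetSet (d t : ℕ) : Set ℝ :=
  {x | ∃ z : ℤ, (t : ℝ) * (1 / (d : ℝ)) + x ≤ (z : ℝ) ∧ (z : ℝ) < ((t : ℝ) + 1) * (1 / (d : ℝ)) + x}

lemma mem_sampled {r : Fin k → ℝ} {t : ℕ} {i : Fin k} :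
    i ∈ sampled d r t ↔ r i ∈ offsetSet (d i) t := by
  simp [sampled, offsetSet]

lemma measurableSet_offsetSet (d t : ℕ) : MeasurableSet (offsetSet d t) := by
  have : offsetSet d t = ⋃ z : ℤ, ({x | (t : ℝ) * (1 / (d : ℝ)) + x ≤ (z : ℝ)} ∩
      {x | (z : ℝ) < ((t : ℝ) + 1) * (1 / (d : ℝ)) + x}) := by
    ext x; simp [offsetSet]
  rw [this]
  refine MeasurableSet.iUnion fun z => MeasurableSet.inter ?_ ?_
  · exact measurableSet_le (by fun_prop) (by fun_prop)
  · exact measurableSet_lt (by fun_prop) (by fun_prop)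

/-- For `x` in `(0, 1]` the only integer that the window can contain is `t / d + 1` (integer
division). Dropping the null point `x = 0` excludes the integer `t / d`. -/
lemma offsetSet_inter_Ioc {d : ℕ} (hd : 0 < d) (t : ℕ) :
    offsetSet d t ∩ Set.Ioc 0 1 =
      Set.Ioc (1 - (((t % d : ℕ) : ℝ) + 1) / d) (1 - ((t % d : ℕ) : ℝ) / d) := by
  have hd' : (0 : ℝ) < d := by exact_mod_cast hd
  have ht : (t : ℝ) = d * ((t / d : ℕ) : ℝ) + ((t % d : ℕ) : ℝ) := by
    exact_mod_cast (Nat.div_add_mod t d).symm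
  set q := t / d
  set m := t % d with hm
  have hmd : (m : ℝ) + 1 ≤ d := by exact_mod_cast Nat.mod_lt t hd
  have ha : (t : ℝ) * (1 / (d : ℝ)) = q + (m : ℝ) / d := by rw [ht]; field_simp
  have hb : ((t : ℝ) + 1) * (1 / (d : ℝ)) = q + ((m : ℝ) + 1) / d := by rw [ht]; field_simp; ring
  have h1 : ((m : ℝ) + 1) / d ≤ 1 := by rw [div_le_one hd']; exact hmd
  have h0 : 0 ≤ (m : ℝ) / d := by positivity
  ext x
  simp only [offsetSet, Set.mem_inter_iff, Set.mem_ofPred_eq, Set.mem_Ioc, ha, hb]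
  constructor
  · rintro ⟨⟨z, hz1, hz2⟩, hx0, hx1⟩
    have hzl : (q : ℤ) < z := by
      have : ((q : ℤ) : ℝ) < z := by push_cast; linarith
      exact_mod_cast this
    have hzu : z < (q : ℤ) + 2 := by
      have : (z : ℝ) < ((q : ℤ) + 2 : ℤ) := by push_cast; linarith
      exact_mod_cast this
    have hz : z = (q : ℤ) + 1 := by omega
    subst hz
    push_cast at hz1 hz2
    constructor <;> linarith
  · rintro ⟨hx1, hx2⟩
    refine ⟨⟨(q : ℤ) + 1, ?_, ?_⟩, by linarith, by linarith⟩ <;> push_cast <;> linarith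

/-- The uniform law of a single offset. -/
noncomputable abbrev uniformLaw : Measure ℝ := volume.restrict (Set.Icc (0 : ℝ) 1)

instance : IsProbabilityMeasure uniformLaw := ⟨by simp⟩

instance (k : ℕ) : IsProbabilityMeasure (offsetLaw k) := by
  unfold offsetLaw; infer_instance

lemma uniformLaw_offsetSet {d : ℕ} (hd : 0 < d) (t : ℕ) :
    uniformLaw.real (offsetSet d t) = 1 / d := by
  have hd' : (0 : ℝ) < d := by exact_mod_cast hd
  have h : uniformLaw = volume.restrict (Set.Ioc (0 : ℝ) 1) :=
    Measure.restrict_congr_set Ioc_ae_eq_Icc.symm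
  rw [h, measureReal_restrict_apply (measurableSet_offsetSet d t), offsetSet_inter_Ioc hd,
    Real.volume_real_Ioc_of_le]
  · field_simp; ring
  · have : ((t % d : ℕ) : ℝ) / d ≤ (((t % d : ℕ) : ℝ) + 1) / d := by gcongr; linarith
    linarith

/-- The windows of distinct rounds are disjoint, so they contain distinct integers, at distance at
least one; as a window has length `1 / d i`, this forces `n - m > d i - 1`. -/
lemma sampled_gap (hd : ∀ i, 0 < d i) {r : Fin k → ℝ} {m n : ℕ} (hmn : m < n) {i : Fin k}
    (hm : i ∈ sampled d r m) (hn : i ∈ sampled d r n) : m + d i ≤ n := by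
  rw [mem_sampled] at hm hn
  obtain ⟨z, hz1, hz2⟩ := hm
  obtain ⟨y, hy1, hy2⟩ := hn
  have hd' : (0 : ℝ) < d i := by exact_mod_cast hd i
  have hmn' : (m : ℝ) + 1 ≤ n := by exact_mod_cast hmn
  have h1 : ((m : ℝ) + 1) * (1 / (d i : ℝ)) ≤ n * (1 / (d i : ℝ)) := by gcongr
  have hzy : z + 1 ≤ y := by
    have : (z : ℝ) < y := by linarith
    exact_mod_cast this
  have hzy' : (z : ℝ) + 1 ≤ y := by exact_mod_cast hzy
  have h2 : (m : ℝ) * (1 / (d i : ℝ)) + 1 < ((n : ℝ) + 1) * (1 / (d i : ℝ)) := by linarith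
  have h3 : ((m : ℝ) * (1 / (d i : ℝ)) + 1) * d i < ((n : ℝ) + 1) * (1 / (d i : ℝ)) * d i := by
    gcongr
  have h4 : (m : ℝ) + d i < n + 1 := by
    have e1 : ((m : ℝ) * (1 / (d i : ℝ)) + 1) * d i = m + d i := by field_simp
    have e2 : ((n : ℝ) + 1) * (1 / (d i : ℝ)) * d i = n + 1 := by field_simp
    linarith
  have h5 : m + d i < n + 1 := by exact_mod_cast h4
  omega

lemma sampled_preimage_eq_pi (t : ℕ) (S : Finset (Fin k)) :
    {r : Fin k → ℝ | sampled d r t = S} =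
      Set.univ.pi (fun i => if i ∈ S then offsetSet (d i) t else (offsetSet (d i) t)ᶜ) := by
  ext r
  simp only [Set.mem_ofPred_eq, Finset.ext_iff, mem_sampled, Set.mem_univ_pi]
  refine forall_congr' fun i => ?_
  split_ifs with h <;> simp [h]

lemma measurableSet_sampled_eq (t : ℕ) (S : Finset (Fin k)) :
    MeasurableSet {r : Fin k → ℝ | sampled d r t = S} := by
  rw [sampled_preimage_eq_pi]
  refine MeasurableSet.univ_pi fun i => ?_
  split_ifs
  · exact measurableSet_offsetSet _ _
  · exact (measurableSet_offsetSet _ _).compl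

lemma offsetLaw_sampled_eq (hd : ∀ i, 0 < d i) (t : ℕ) (S : Finset (Fin k)) :
    (offsetLaw k).real {r | sampled d r t = S} =
      bernoulliWeight (fun i => 1 / (d i : ℝ)) S := by
  rw [sampled_preimage_eq_pi, offsetLaw, measureReal_def, Measure.pi_pi, ENNReal.toReal_prod,
    bernoulliWeight]
  refine Finset.prod_congr rfl fun i _ => ?_
  rw [← measureReal_def]
  split_ifs
  · exact uniformLaw_offsetSet (hd i) t
  · rw [probReal_compl_eq_one_sub (measurableSet_offsetSet _ _), uniformLaw_offsetSet (hd i) t]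

lemma integrable_and_integral_sampled (hd : ∀ i, 0 < d i) (t : ℕ) (g : Finset (Fin k) → ℝ) :
    Integrable (fun r => g (sampled d r t)) (offsetLaw k) ∧
    ∫ r, g (sampled d r t) ∂(offsetLaw k) = multilinearExt g (fun i => 1 / (d i : ℝ)) := by
  classical
  have h : (fun r => g (sampled d r t)) = fun r => ∑ S : Finset (Fin k),
      {r : Fin k → ℝ | sampled d r t = S}.indicator (fun _ => g S) r := by
    ext r
    simp [Set.indicator_apply]
  have hi : ∀ S ∈ (Finset.univ : Finset (Finset (Fin k))),
      Integrable ({r : Fin k → ℝ | sampled d r t = S}.indicator (fun _ => g S)) (offsetLaw k) :=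
    fun S _ => (integrable_const _).indicator (measurableSet_sampled_eq t S)
  rw [h]
  refine ⟨integrable_finsetSum _ hi, ?_⟩
  rw [integral_finsetSum _ hi, multilinearExt]
  refine Finset.sum_congr rfl fun S _ => ?_
  rw [integral_indicator_const _ (measurableSet_sampled_eq t S), offsetLaw_sampled_eq hd,
    smul_eq_mul]

end Sampling

/-! ### Resampling the rewards of one round -/

section Resampling

variable {S E : Type} [MeasurableSpace S] [MeasurableSpace E]

/-- Checked on finite-dimensional boxes, which determine the infinite product measure. -/
lemma measurePreserving_update (ν : Measure E) [IsProbabilityMeasure ν] (n : ℕ) :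
    MeasurePreserving (fun p : (ℕ → E) × E => Function.update p.1 n p.2)
      ((Measure.infinitePi (fun _ : ℕ => ν)).prod ν) (Measure.infinitePi (fun _ : ℕ => ν)) := by
  have hmeas : Measurable (fun p : (ℕ → E) × E => Function.update p.1 n p.2) := by
    refine measurable_pi_lambda _ fun m => ?_
    by_cases h : m = n
    · subst h; simpa using measurable_snd
    · simp only [Function.update_of_ne h]
      fun_prop
  refine ⟨hmeas, Measure.eq_infinitePi _ fun s t ht => ?_⟩
  rw [Measure.map_apply hmeas (MeasurableSet.pi s.countable_toSet fun i _ => ht i)]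
  have h : (fun p : (ℕ → E) × E => Function.update p.1 n p.2) ⁻¹' (Set.pi s t) =
      (Set.pi (s.erase n : Finset ℕ) t) ×ˢ (if n ∈ s then t n else Set.univ) := by
    ext ⟨X, y⟩
    simp only [Set.mem_preimage, Set.mem_pi, Finset.mem_coe, Set.mem_prod, Finset.mem_erase]
    constructor
    · intro h
      refine ⟨fun m hm => by simpa [hm.1] using h m hm.2, ?_⟩
      split_ifs with hn
      · simpa using h n hn
      · trivial
    · rintro ⟨h1, h2⟩ m hm
      by_cases hmn : m = n
      · subst hmn; simpa [hm] using h2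
      · simpa [hmn] using h1 m ⟨hmn, hm⟩
  rw [h, Measure.prod_prod, Measure.infinitePi_pi _ fun i _ => ht i]
  split_ifs with hn
  · exact Finset.prod_erase_mul s (fun i => ν (t i)) hn
  · simp [Finset.erase_eq_of_notMem hn]

/-- The joint law of the seed and the rewards of all rounds. -/
noncomputable abbrev jointLaw (ρ : Measure S) (ν : Measure E) [IsProbabilityMeasure ν] :
    Measure (S × (ℕ → E)) :=
  ρ.prod (Measure.infinitePi (fun _ : ℕ => ν))

/-- Replace the rewards of one round. -/
def resample (n : ℕ) (p : (S × (ℕ → E)) × E) : S × (ℕ → E) :=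
  (p.1.1, Function.update p.1.2 n p.2)

lemma measurePreserving_resample (ρ : Measure S) [IsProbabilityMeasure ρ] (ν : Measure E)
    [IsProbabilityMeasure ν] (n : ℕ) :
    MeasurePreserving (resample n) ((jointLaw ρ ν).prod ν) (jointLaw ρ ν) :=
  ((MeasurePreserving.id ρ).prod (measurePreserving_update ν n)).comp
    (measurePreserving_prodAssoc ρ (Measure.infinitePi (fun _ : ℕ => ν)) ν)

end Resampling

section Play

variable {k : ℕ} {S : Type}

lemma history_congr (π : Policy k S) (s : S) {X Y : ℕ → Fin k → ℝ} {n : ℕ}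
    (h : ∀ m < n, X m = Y m) : history π s X n = history π s Y n := by
  induction n with
  | zero => rfl
  | succ n ih =>
    have := ih fun m hm => h m (hm.trans n.lt_succ_self)
    simp only [history, this, h n n.lt_succ_self]

lemma play_update (π : Policy k S) (s : S) (X : ℕ → Fin k → ℝ) (y : Fin k → ℝ) {m n : ℕ}
    (h : m ≤ n) : play π s (Function.update X n y) m = play π s X m := by
  unfold play
  rw [history_congr π s fun l hl => Function.update_of_ne (hl.trans_le h).ne y X]

variable [MeasurableSpace S] {π : Policy k S}

lemma measurableSet_mem_play {n : ℕ}
    (hπ : ∀ A : Finset (Fin k),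
      MeasurableSet {ω : S × (ℕ → Fin k → ℝ) | play π ω.1 ω.2 n = A}) (i : Fin k) :
    MeasurableSet {ω : S × (ℕ → Fin k → ℝ) | i ∈ play π ω.1 ω.2 n} := by
  have : {ω : S × (ℕ → Fin k → ℝ) | i ∈ play π ω.1 ω.2 n} =
      ⋃ A ∈ {A : Finset (Fin k) | i ∈ A}, {ω | play π ω.1 ω.2 n = A} := by
    ext ω; simp
  rw [this]
  exact MeasurableSet.biUnion (Set.to_countable _) fun A _ => hπ A

end Play

/-! ### The expected reward in terms of the mean rewards -/

section Rewards

variable {k : ℕ} {S : Type} [MeasurableSpace S] {ρ : Measure S} [IsProbabilityMeasure ρ]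
  {ν : Measure (Fin k → ℝ)} [IsProbabilityMeasure ν] {π : Policy k S}

/-- The mean reward of an arm. -/
noncomputable def meanReward (ν : Measure (Fin k → ℝ)) (i : Fin k) : ℝ := ∫ x, x i ∂ν

lemma meanReward_mem_Icc (hν : ∀ᵐ x ∂ν, ∀ i, x i ∈ Set.Icc (0 : ℝ) 1) (i : Fin k) :
    meanReward ν i ∈ Set.Icc (0 : ℝ) 1 := by
  have hi : ∀ᵐ x ∂ν, x i ∈ Set.Icc (0 : ℝ) 1 := hν.mono fun x hx => hx i
  have hint : Integrable (fun x : Fin k → ℝ => x i) ν :=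
    Integrable.of_mem_Icc 0 1 (measurable_pi_apply i).aemeasurable hi
  refine ⟨integral_nonneg_of_ae (hi.mono fun x hx => hx.1), ?_⟩
  calc meanReward ν i ≤ ∫ _, (1 : ℝ) ∂ν :=
        integral_mono_ae hint (integrable_const _) (hi.mono fun x hx => hx.2)
    _ = 1 := by simp

lemma ae_rewards_mem_Icc (hν : ∀ᵐ x ∂ν, ∀ i, x i ∈ Set.Icc (0 : ℝ) 1) (n : ℕ) :
    ∀ᵐ ω ∂(jointLaw ρ ν), ∀ i, ω.2 n i ∈ Set.Icc (0 : ℝ) 1 := by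
  have h : MeasurePreserving (fun ω : S × (ℕ → Fin k → ℝ) => ω.2 n) (jointLaw ρ ν) ν :=
    (measurePreserving_eval_infinitePi (fun _ : ℕ => ν) n).comp measurePreserving_snd
  exact h.quasiMeasurePreserving.ae hν

lemma sum_play_eq (A : Finset (Fin k)) (x : Fin k → ℝ) :
    ∑ i ∈ A, x i = ∑ i, (if i ∈ A then 1 else 0) * x i := by
  simp [Finset.sum_ite_mem]

lemma measurable_indicator_play
    (hπ : ∀ (n : ℕ) (A : Finset (Fin k)),
      MeasurableSet {ω : S × (ℕ → Fin k → ℝ) | play π ω.1 ω.2 n = A}) (n : ℕ) (i : Fin k) :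
    Measurable fun ω : S × (ℕ → Fin k → ℝ) => if i ∈ play π ω.1 ω.2 n then (1 : ℝ) else 0 :=
  Measurable.ite (measurableSet_mem_play (hπ n) i) measurable_const measurable_const

lemma measurable_reward (n : ℕ) (i : Fin k) :
    Measurable fun ω : S × (ℕ → Fin k → ℝ) => ω.2 n i := by fun_prop

lemma integrable_indicator_play
    (hπ : ∀ (n : ℕ) (A : Finset (Fin k)),
      MeasurableSet {ω : S × (ℕ → Fin k → ℝ) | play π ω.1 ω.2 n = A}) (n : ℕ) (i : Fin k) :
    Integrable (fun ω : S × (ℕ → Fin k → ℝ) => if i ∈ play π ω.1 ω.2 n then (1 : ℝ) else 0)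
      (jointLaw ρ ν) := by
  refine Integrable.of_mem_Icc 0 1 (measurable_indicator_play hπ n i).aemeasurable
    (Filter.Eventually.of_forall fun ω => ?_)
  split_ifs <;> simp

lemma integrable_sum_means
    (hπ : ∀ (n : ℕ) (A : Finset (Fin k)),
      MeasurableSet {ω : S × (ℕ → Fin k → ℝ) | play π ω.1 ω.2 n = A}) (n : ℕ) (μ : Fin k → ℝ) :
    Integrable (fun ω : S × (ℕ → Fin k → ℝ) => ∑ i ∈ play π ω.1 ω.2 n, μ i)
      (jointLaw ρ ν) := by
  simp_rw [sum_play_eq (play _ _ _ _)]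
  exact integrable_finsetSum _ fun i _ => (integrable_indicator_play hπ n i).mul_const _

/-- Replacing the rewards of round `n` by a fresh copy leaves the set played there unchanged, so the
expectation factorises. -/
lemma expectedReward_eq (hν : ∀ᵐ x ∂ν, ∀ i, x i ∈ Set.Icc (0 : ℝ) 1)
    (hπ : ∀ (n : ℕ) (A : Finset (Fin k)),
      MeasurableSet {ω : S × (ℕ → Fin k → ℝ) | play π ω.1 ω.2 n = A}) (T : ℕ) :
    expectedReward ρ ν π T =
      ∑ n ∈ Finset.range T, ∫ ω, ∑ i ∈ play π ω.1 ω.2 n, meanReward ν i ∂(jointLaw ρ ν) := by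
  have hint : ∀ n i, Integrable (fun ω : S × (ℕ → Fin k → ℝ) =>
      (if i ∈ play π ω.1 ω.2 n then (1 : ℝ) else 0) * ω.2 n i) (jointLaw ρ ν) := by
    intro n i
    refine Integrable.of_mem_Icc 0 1
      ((measurable_indicator_play hπ n i).mul (measurable_reward n i)).aemeasurable ?_
    filter_upwards [ae_rewards_mem_Icc hν n] with ω hω
    split_ifs
    · simpa using hω i
    · simp
  have hterm : ∀ n i, ∫ ω, (if i ∈ play π ω.1 ω.2 n then (1 : ℝ) else 0) * ω.2 n i
      ∂(jointLaw ρ ν) =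
      ∫ ω, (if i ∈ play π ω.1 ω.2 n then (1 : ℝ) else 0) * meanReward ν i ∂(jointLaw ρ ν) := by
    intro n i
    have hR := measurePreserving_resample ρ ν n
    have hmap := integral_map (μ := (jointLaw ρ ν).prod ν) hR.measurable.aemeasurable
      ((measurable_indicator_play hπ n i).mul (measurable_reward n i)).aestronglyMeasurable
    rw [hR.map_eq] at hmap
    refine hmap.trans ?_
    simp only [Pi.mul_apply]
    simp only [resample, play_update π _ _ _ le_rfl, Function.update_self]
    rw [integral_prod_mul (fun ω : S × (ℕ → Fin k → ℝ) =>
      if i ∈ play π ω.1 ω.2 n then (1 : ℝ) else 0) (fun y : Fin k → ℝ => y i),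
      integral_mul_const]
    rfl
  unfold expectedReward totalReward
  rw [integral_finsetSum]
  · refine Finset.sum_congr rfl fun n _ => ?_
    simp_rw [sum_play_eq (play _ _ _ _)]
    rw [integral_finsetSum _ fun i _ => hint n i,
      integral_finsetSum _ fun i _ => (integrable_indicator_play hπ n i).mul_const _]
    exact Finset.sum_congr rfl fun i _ => hterm n i
  · intro n _
    simp_rw [sum_play_eq (play _ _ _ _)]
    exact integrable_finsetSum _ fun i _ => hint n i

end Rewards

/-! ### Concentration of the empirical means under adaptive sampling -/

section Concentration

variable {k : ℕ} {S : Type}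

/-- The number of the first `n` rounds in which arm `i` is played. -/
def playCount (π : Policy k S) (i : Fin k) (n : ℕ) (ω : S × (ℕ → Fin k → ℝ)) : ℕ :=
  ∑ m ∈ Finset.range n, if i ∈ play π ω.1 ω.2 m then 1 else 0

/-- The sum of the centred rewards collected from arm `i` in the first `n` rounds. -/
def deviation (π : Policy k S) (c : ℝ) (i : Fin k) (n : ℕ) (ω : S × (ℕ → Fin k → ℝ)) : ℝ :=
  ∑ m ∈ Finset.range n, if i ∈ play π ω.1 ω.2 m then ω.2 m i - c else 0

lemma playCount_le (π : Policy k S) (i : Fin k) (n : ℕ) (ω : S × (ℕ → Fin k → ℝ)) :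
    playCount π i n ω ≤ n := by
  calc playCount π i n ω ≤ ∑ m ∈ Finset.range n, 1 :=
        Finset.sum_le_sum fun m _ => by split_ifs <;> simp
    _ = n := by simp

variable [MeasurableSpace S] {ρ : Measure S} [IsProbabilityMeasure ρ]
  {ν : Measure (Fin k → ℝ)} [IsProbabilityMeasure ν] {π : Policy k S}

lemma measurable_playCount {n : ℕ}
    (hπ : ∀ m < n, ∀ A : Finset (Fin k),
      MeasurableSet {ω : S × (ℕ → Fin k → ℝ) | play π ω.1 ω.2 m = A}) (i : Fin k) :
    Measurable (playCount π i n) := by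
  unfold playCount
  exact Finset.measurable_fun_sum _ fun m hm =>
    Measurable.ite (measurableSet_mem_play (hπ m (Finset.mem_range.1 hm)) i) measurable_const measurable_const

lemma measurable_deviation {n : ℕ}
    (hπ : ∀ m < n, ∀ A : Finset (Fin k),
      MeasurableSet {ω : S × (ℕ → Fin k → ℝ) | play π ω.1 ω.2 m = A}) (c : ℝ) (i : Fin k) : Measurable (deviation π c i n) := by
  unfold deviation
  exact Finset.measurable_fun_sum _ fun m hm =>
    Measurable.ite (measurableSet_mem_play (hπ m (Finset.mem_range.1 hm)) i) ((measurable_reward m i).sub_const c)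
      measurable_const

/-- Hoeffding's lemma: a variable in an interval of length one is sub-Gaussian with variance proxy
`1/4`. -/
lemma lintegral_exp_reward_le (hν : ∀ᵐ x ∂ν, ∀ i, x i ∈ Set.Icc (0 : ℝ) 1) (i : Fin k) (l : ℝ) :
    ∫⁻ y, ENNReal.ofReal (Real.exp (l * (y i - meanReward ν i) - l ^ 2 / 8)) ∂ν ≤ 1 := by
  have hi : ∀ᵐ x ∂ν, x i ∈ Set.Icc (0 : ℝ) 1 := hν.mono fun x hx => hx i
  have hsub := ProbabilityTheory.hasSubgaussianMGF_of_mem_Icc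
    (measurable_pi_apply i).aemeasurable hi
  have h1 := hsub.integrable_exp_mul l
  have h2 := hsub.mgf_le l
  have hexp : ∀ y : Fin k → ℝ, Real.exp (l * (y i - meanReward ν i) - l ^ 2 / 8) =
      Real.exp (l * (y i - ∫ x, x i ∂ν)) * Real.exp (-(l ^ 2 / 8)) := by
    intro y; rw [← Real.exp_add]; rfl
  simp_rw [hexp]
  rw [← ofReal_integral_eq_lintegral_ofReal (h1.mul_const _)
    (Filter.Eventually.of_forall fun y => by positivity), ← ENNReal.ofReal_one]
  refine ENNReal.ofReal_le_ofReal ?_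
  rw [integral_mul_const]
  calc _ ≤ Real.exp (((‖(1 : ℝ) - 0‖₊ / 2) ^ 2 : NNReal) * l ^ 2 / 2) *
        Real.exp (-(l ^ 2 / 8)) :=
        mul_le_mul_of_nonneg_right h2 (Real.exp_pos _).le
    _ = 1 := by
        rw [← Real.exp_add, Real.exp_eq_one_iff]
        push_cast
        simp
        ring

/-- The integrand is a supermartingale: integrating out the fresh rewards of the last round gives a
factor at most one if the arm is played, and changes nothing otherwise. -/
lemma lintegral_exp_deviation_le (hν : ∀ᵐ x ∂ν, ∀ i, x i ∈ Set.Icc (0 : ℝ) 1)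
    (hπ : ∀ (n : ℕ) (A : Finset (Fin k)),
      MeasurableSet {ω : S × (ℕ → Fin k → ℝ) | play π ω.1 ω.2 n = A}) (i : Fin k) (l : ℝ)
    (n : ℕ) :
    ∫⁻ ω, ENNReal.ofReal (Real.exp (l * deviation π (meanReward ν i) i n ω -
      l ^ 2 / 8 * playCount π i n ω)) ∂(jointLaw ρ ν) ≤ 1 := by
  have hmeas : ∀ n, Measurable fun ω : S × (ℕ → Fin k → ℝ) =>
      ENNReal.ofReal (Real.exp (l * deviation π (meanReward ν i) i n ω -
        l ^ 2 / 8 * playCount π i n ω)) := by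
    intro n
    have h1 := measurable_deviation (n := n) (fun m _ => hπ m) (meanReward ν i) i
    have h2 : Measurable fun ω => (playCount π i n ω : ℝ) :=
      measurable_from_top.comp (measurable_playCount (fun m _ => hπ m) i)
    fun_prop
  induction n with
  | zero => simp [deviation, playCount]
  | succ n ih =>
    have hR := measurePreserving_resample ρ ν n
    have hmeas' : Measurable fun p => ENNReal.ofReal (Real.exp
        (l * deviation π (meanReward ν i) i (n + 1) (resample n p) -
          l ^ 2 / 8 * playCount π i (n + 1) (resample n p))) :=
      (hmeas (n + 1)).comp hR.measurable
    rw [← hR.lintegral_comp (hmeas (n + 1)), lintegral_prod _ hmeas'.aemeasurable]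
    refine le_trans (lintegral_mono fun ω => ?_) ih
    have hplay : ∀ y, ∀ m ≤ n, play π (resample n (ω, y)).1 (resample n (ω, y)).2 m =
        play π ω.1 ω.2 m := fun y m hm => play_update π ω.1 ω.2 y hm
    have hd : ∀ y, deviation π (meanReward ν i) i (n + 1) (resample n (ω, y)) =
        deviation π (meanReward ν i) i n ω +
          if i ∈ play π ω.1 ω.2 n then y i - meanReward ν i else 0 := by
      intro y
      have h1 : (resample n (ω, y)).2 n = y := by simp [resample]
      simp only [deviation, Finset.sum_range_succ, hplay y n le_rfl, h1]
      congr 1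
      refine Finset.sum_congr rfl fun m hm => ?_
      have hm' := Finset.mem_range.1 hm
      have h2 : (resample n (ω, y)).2 m = ω.2 m := by
        simp [resample, hm'.ne]
      simp only [hplay y m hm'.le, h2]
    have hc : ∀ y, playCount π i (n + 1) (resample n (ω, y)) =
        playCount π i n ω + if i ∈ play π ω.1 ω.2 n then 1 else 0 := by
      intro y
      simp only [playCount, Finset.sum_range_succ, hplay y n le_rfl]
      congr 1
      refine Finset.sum_congr rfl fun m hm => ?_
      simp only [hplay y m (Finset.mem_range.1 hm).le]
    simp only [hd, hc]
    by_cases h : i ∈ play π ω.1 ω.2 n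
    · simp only [if_pos h]
      have he : ∀ y : Fin k → ℝ, ENNReal.ofReal (Real.exp
          (l * (deviation π (meanReward ν i) i n ω + (y i - meanReward ν i)) -
            l ^ 2 / 8 * ((playCount π i n ω + 1 : ℕ) : ℝ))) =
          ENNReal.ofReal (Real.exp (l * deviation π (meanReward ν i) i n ω -
            l ^ 2 / 8 * playCount π i n ω)) *
          ENNReal.ofReal (Real.exp (l * (y i - meanReward ν i) - l ^ 2 / 8)) := by
        intro y
        rw [← ENNReal.ofReal_mul (Real.exp_pos _).le, ← Real.exp_add]
        congr 2
        push_cast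
        ring
      simp_rw [he]
      rw [lintegral_const_mul _ (by fun_prop)]
      exact mul_le_of_le_one_right' (lintegral_exp_reward_le hν i l)
    · simp [h]

lemma measure_deviation_le (hν : ∀ᵐ x ∂ν, ∀ i, x i ∈ Set.Icc (0 : ℝ) 1)
    (hπ : ∀ (n : ℕ) (A : Finset (Fin k)),
      MeasurableSet {ω : S × (ℕ → Fin k → ℝ) | play π ω.1 ω.2 n = A}) (i : Fin k) (n : ℕ)
    {s : ℕ} (hs : 0 < s) {L : ℝ} (hL : 0 ≤ L) {σ : ℝ} (hσ : σ ^ 2 = 1) :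
    (jointLaw ρ ν).real {ω | playCount π i n ω = s ∧
      Real.sqrt (2 * s * L) < σ * deviation π (meanReward ν i) i n ω} ≤ Real.exp (-(4 * L)) := by
  have hs' : (0 : ℝ) < s := by exact_mod_cast hs
  -- The optimal Chernoff parameter: on the event the linear term is at least `8 * L` and the
  -- quadratic term equals `4 * L`. The sign `σ` covers both tails.
  set l : ℝ := σ * (4 * Real.sqrt (2 * L / s)) with hl
  have hl2 : l ^ 2 / 8 * s = 4 * L := by
    rw [hl, mul_pow, hσ, mul_pow, Real.sq_sqrt (by positivity)]
    field_simp
    ring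
  have hprod : Real.sqrt (2 * L / s) * Real.sqrt (2 * s * L) = 2 * L := by
    rw [← Real.sqrt_mul (by positivity)]
    have : 2 * L / s * (2 * s * L) = (2 * L) ^ 2 := by field_simp
    rw [this, Real.sqrt_sq (by positivity)]
  have hmarkov := mul_meas_ge_le_lintegral₀ (μ := jointLaw ρ ν)
    (f := fun ω => ENNReal.ofReal (Real.exp (l * deviation π (meanReward ν i) i n ω -
      l ^ 2 / 8 * playCount π i n ω))) (by
    have h1 := measurable_deviation (n := n) (fun m _ => hπ m) (meanReward ν i) i
    have h2 : Measurable fun ω => (playCount π i n ω : ℝ) :=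
      measurable_from_top.comp (measurable_playCount (fun m _ => hπ m) i)
    fun_prop) (ENNReal.ofReal (Real.exp (4 * L)))
  have hle := hmarkov.trans (lintegral_exp_deviation_le hν hπ i l n)
  have hsub : {ω | playCount π i n ω = s ∧
      Real.sqrt (2 * s * L) < σ * deviation π (meanReward ν i) i n ω} ⊆
      {ω | ENNReal.ofReal (Real.exp (4 * L)) ≤
        ENNReal.ofReal (Real.exp (l * deviation π (meanReward ν i) i n ω -
          l ^ 2 / 8 * playCount π i n ω))} := by
    rintro ω ⟨h1, h2⟩
    refine ENNReal.ofReal_le_ofReal (Real.exp_le_exp.2 ?_)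
    rw [h1, hl2]
    have h3 : 4 * Real.sqrt (2 * L / s) * Real.sqrt (2 * s * L) ≤
        4 * Real.sqrt (2 * L / s) * (σ * deviation π (meanReward ν i) i n ω) :=
      mul_le_mul_of_nonneg_left h2.le (by positivity)
    have h4 : l * deviation π (meanReward ν i) i n ω =
      4 * Real.sqrt (2 * L / s) * (σ * deviation π (meanReward ν i) i n ω) := by rw [hl]; ring
    rw [h4]
    nlinarith
  have h5 : ENNReal.ofReal (Real.exp (4 * L)) * (jointLaw ρ ν) {ω | playCount π i n ω = s ∧
      Real.sqrt (2 * s * L) < σ * deviation π (meanReward ν i) i n ω} ≤ 1 :=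
    le_trans (by gcongr) hle
  have h6 := ENNReal.toReal_mono ENNReal.one_ne_top h5
  rw [ENNReal.toReal_mul, ENNReal.toReal_ofReal (Real.exp_pos _).le, ENNReal.toReal_one,
    ← measureReal_def] at h6
  rw [Real.exp_neg, ← one_div, le_div_iff₀' (Real.exp_pos _)]
  exact h6

/-- The event that, after `n` rounds, the empirical mean of some arm is far from its mean. -/
def deviationEvent (π : Policy k S) (μ : Fin k → ℝ) (n : ℕ) : Set (S × (ℕ → Fin k → ℝ)) :=
  {ω | ∃ i, 0 < playCount π i n ω ∧
    Real.sqrt (2 * playCount π i n ω * Real.log ((n + 1 : ℕ) : ℝ)) < |deviation π (μ i) i n ω|}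

lemma measurableSet_deviationEvent
    (hπ : ∀ (n : ℕ) (A : Finset (Fin k)),
      MeasurableSet {ω : S × (ℕ → Fin k → ℝ) | play π ω.1 ω.2 n = A}) (μ : Fin k → ℝ) (n : ℕ) :
    MeasurableSet (deviationEvent π μ n) := by
  have : deviationEvent π μ n = ⋃ i, ({ω | 0 < playCount π i n ω} ∩
      {ω | Real.sqrt (2 * playCount π i n ω * Real.log ((n + 1 : ℕ) : ℝ)) <
        |deviation π (μ i) i n ω|}) := by
    ext ω; simp [deviationEvent]
  rw [this]
  refine MeasurableSet.iUnion fun i => MeasurableSet.inter ?_ ?_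
  · exact measurableSet_lt measurable_const (measurable_playCount (fun m _ => hπ m) i)
  · have h1 := measurable_deviation (n := n) (fun m _ => hπ m) (μ i) i
    have h2 : Measurable fun ω => (playCount π i n ω : ℝ) :=
      measurable_from_top.comp (measurable_playCount (fun m _ => hπ m) i)
    exact measurableSet_lt (by fun_prop) (by fun_prop)

/-- The play count is random, so the union bound runs over arms, over its at most `n` positive
values and over two signs, each with probability at most `(n + 1)⁻⁴`. -/
lemma measure_deviationEvent_le (hν : ∀ᵐ x ∂ν, ∀ i, x i ∈ Set.Icc (0 : ℝ) 1)
    (hπ : ∀ (n : ℕ) (A : Finset (Fin k)),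
      MeasurableSet {ω : S × (ℕ → Fin k → ℝ) | play π ω.1 ω.2 n = A}) (n : ℕ) :
    (jointLaw ρ ν).real (deviationEvent π (meanReward ν) n) ≤ 2 * k * (1 / ((n : ℝ) + 1) ^ 3) := by
  set L := Real.log ((n + 1 : ℕ) : ℝ) with hLdef
  have hL : 0 ≤ L := Real.log_natCast_nonneg _
  set B : Fin k → ℕ → ℝ → Set (S × (ℕ → Fin k → ℝ)) := fun i s σ =>
    {ω | playCount π i n ω = s ∧
      Real.sqrt (2 * s * L) < σ * deviation π (meanReward ν i) i n ω}
  have hsub : deviationEvent π (meanReward ν) n ⊆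
      ⋃ i ∈ (Finset.univ : Finset (Fin k)), ⋃ s ∈ Finset.Icc 1 n, (B i s 1 ∪ B i s (-1)) := by
    rintro ω ⟨i, hpos, hdev⟩
    simp only [Set.mem_iUnion, Finset.mem_univ, exists_prop, true_and]
    refine ⟨i, playCount π i n ω, Finset.mem_Icc.2 ⟨hpos, playCount_le π i n ω⟩, ?_⟩
    rcases lt_abs.1 hdev with h | h
    · exact Or.inl ⟨rfl, by rw [one_mul]; exact h⟩
    · exact Or.inr ⟨rfl, by rw [neg_one_mul]; exact h⟩
  have hexp : Real.exp (-(4 * L)) = 1 / ((n : ℝ) + 1) ^ 4 := by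
    have : ((n + 1 : ℕ) : ℝ) = Real.exp L := (Real.exp_log (by positivity)).symm
    push_cast at this
    rw [this, ← Real.exp_nat_mul, Real.exp_neg, one_div]
    norm_num
  have hB : ∀ i, ∀ s ∈ Finset.Icc 1 n, (jointLaw ρ ν).real (B i s 1 ∪ B i s (-1)) ≤
      2 * (1 / ((n : ℝ) + 1) ^ 4) := by
    intro i s hs
    have hs' := (Finset.mem_Icc.1 hs).1
    have h1 := measure_deviation_le (ρ := ρ) hν hπ i n hs' hL (σ := 1) (by norm_num)
    have h2 := measure_deviation_le (ρ := ρ) hν hπ i n hs' hL (σ := -1) (by norm_num)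
    rw [hexp] at h1 h2
    linarith [measureReal_union_le (μ := jointLaw ρ ν) (B i s 1) (B i s (-1))]
  have h1 : ∀ i, (jointLaw ρ ν).real (⋃ s ∈ Finset.Icc 1 n, (B i s 1 ∪ B i s (-1))) ≤
      n * (2 * (1 / ((n : ℝ) + 1) ^ 4)) := by
    intro i
    refine (measureReal_biUnion_finset_le _ _).trans ((Finset.sum_le_sum (hB i)).trans ?_)
    simp
  have h2 : (jointLaw ρ ν).real (deviationEvent π (meanReward ν) n) ≤
      k * (n * (2 * (1 / ((n : ℝ) + 1) ^ 4))) := by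
    refine (measureReal_mono hsub (measure_ne_top _ _)).trans ((measureReal_biUnion_finset_le _ _).trans
      ((Finset.sum_le_sum fun i _ => h1 i).trans ?_))
    simp
  have h3 : (n : ℝ) * (1 / ((n : ℝ) + 1) ^ 4) ≤ 1 / ((n : ℝ) + 1) ^ 3 := by
    rw [mul_one_div, div_le_div_iff₀ (by positivity) (by positivity)]
    have : (0 : ℝ) ≤ n := Nat.cast_nonneg n
    have h4 : (0 : ℝ) ≤ ((n : ℝ) + 1) ^ 3 := by positivity
    nlinarith
  have hk : (0 : ℝ) ≤ k := Nat.cast_nonneg k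
  nlinarith

end Concentration

/-! ### The statistics of the history -/

section History

variable {k : ℕ} {S : Type} (π : Policy k S)

lemma length_history (s : S) (X : ℕ → Fin k → ℝ) (n : ℕ) : (history π s X n).length = n := by
  induction n with
  | zero => rfl
  | succ n ih => simp [history, ih]

lemma map_fst_history_succ (s : S) (X : ℕ → Fin k → ℝ) (n : ℕ) :
    (history π s X (n + 1)).map Prod.fst = play π s X n :: (history π s X n).map Prod.fst := rfl

lemma pulls_history (ω : S × (ℕ → Fin k → ℝ)) (n : ℕ) (i : Fin k) :
    pulls (history π ω.1 ω.2 n) i = playCount π i n ω := by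
  induction n with
  | zero => rfl
  | succ n ih =>
    rw [playCount, Finset.sum_range_succ, ← playCount, ← ih]
    simp only [pulls, history, List.filter_cons, play]
    split_ifs with h1 h2 h2 <;> simp_all

lemma empMean_history (ω : S × (ℕ → Fin k → ℝ)) (n : ℕ) (i : Fin k) :
    empMean (history π ω.1 ω.2 n) i = deviation π 0 i n ω / playCount π i n ω := by
  rw [empMean, pulls_history]
  congr 1
  induction n with
  | zero => rfl
  | succ n ih =>
    rw [deviation, Finset.sum_range_succ, ← deviation, ← ih]
    simp only [history, List.filter_cons, play]
    split_ifs with h1 h2 h2 <;> simp_all [add_comm]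

lemma deviation_zero_eq (c : ℝ) (ω : S × (ℕ → Fin k → ℝ)) (n : ℕ) (i : Fin k) :
    deviation π 0 i n ω = deviation π c i n ω + playCount π i n ω * c := by
  simp only [deviation, playCount, Nat.cast_sum, Finset.sum_mul, ← Finset.sum_add_distrib]
  refine Finset.sum_congr rfl fun m _ => ?_
  split_ifs <;> simp

end History

/-! ### Admissibility of the algorithm -/

section Admissible

variable {k : ℕ} (M : Matroid (Fin k)) (d : Fin k → ℕ)
  (tie : List (Finset (Fin k)) → Equiv.Perm (Fin k))

open Classical in
/-- The arms of `G`, sorted by the relation `R`; the order `σ` is used where `R` is undecided. -/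
noncomputable def sortedArms (σ : Equiv.Perm (Fin k)) (G : Finset (Fin k))
    (R : Fin k → Fin k → Prop) : List (Fin k) :=
  ((List.ofFn σ).filter (fun i => i ∈ G)).insertionSort R

lemma toFinset_sortedArms (σ : Equiv.Perm (Fin k)) (G : Finset (Fin k))
    (R : Fin k → Fin k → Prop) : (sortedArms σ G R).toFinset = G := by
  ext i
  simp only [sortedArms, List.mem_toFinset, List.mem_insertionSort, List.mem_filter, List.mem_ofFn,
    decide_eq_true_eq]
  exact ⟨fun h => h.2, fun h => ⟨⟨σ.symm i, by simp⟩, h⟩⟩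

lemma pairwise_sortedArms (σ : Equiv.Perm (Fin k)) (G : Finset (Fin k))
    (R : Fin k → Fin k → Prop) [Std.Total R] [IsTrans (Fin k) R] : (sortedArms σ G R).Pairwise R := by
  classical
  exact List.pairwise_insertionSort R _

lemma interleavedUCB_eq (r : Fin k → ℝ) (h : History k) :
    interleavedUCB M d tie r h = greedy M (sortedArms (tie (h.map Prod.fst))
      (sampled d r (h.length + 1)) (fun i j => ucbIndex h j ≤ ucbIndex h i)) := by
  unfold interleavedUCB sortedArms
  congr!

lemma measurable_ucbIndex {S : Type} [MeasurableSpace S] {π : Policy k S} {n : ℕ}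
    (hπ : ∀ m < n, ∀ A : Finset (Fin k),
      MeasurableSet {ω : S × (ℕ → Fin k → ℝ) | play π ω.1 ω.2 m = A}) (i : Fin k) :
    Measurable fun ω : S × (ℕ → Fin k → ℝ) => ucbIndex (history π ω.1 ω.2 n) i := by
  have h1 := measurable_deviation hπ 0 i
  have h2 := measurable_playCount hπ i
  have h3 : Measurable fun ω => (playCount π i n ω : ℝ) := measurable_from_top.comp h2
  simp only [ucbIndex, pulls_history, empMean_history, length_history]
  refine Measurable.ite (h2 (measurableSet_singleton 0)) measurable_const ?_
  refine Measurable.coe_real_ereal ?_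
  fun_prop

/-- The history contains real rewards, but the play depends only on countably-valued data: the sets
played so far, the sampled set and the comparison relation of the indices. The event splits over
these values; strong induction makes the indices measurable. -/
lemma measurableSet_play_interleavedUCB (n : ℕ) (A : Finset (Fin k)) :
    MeasurableSet {ω : (Fin k → ℝ) × (ℕ → Fin k → ℝ) |
      play (interleavedUCB M d tie) ω.1 ω.2 n = A} := by
  induction n using Nat.strong_induction_on generalizing A with
  | _ n ih =>
  have hlist : ∀ m ≤ n, ∀ L : List (Finset (Fin k)),
      MeasurableSet {ω : (Fin k → ℝ) × (ℕ → Fin k → ℝ) |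
        (history (interleavedUCB M d tie) ω.1 ω.2 m).map Prod.fst = L} := by
    intro m
    induction m with
    | zero => intro _ L; simp [history]
    | succ m ihm =>
      intro hm L
      simp_rw [map_fst_history_succ]
      cases L with
      | nil => simp
      | cons B L =>
        simp only [List.cons.injEq]
        exact (ih m hm B).inter (ihm (Nat.le_of_succ_le hm) L)
  have hset : {ω : (Fin k → ℝ) × (ℕ → Fin k → ℝ) |
      play (interleavedUCB M d tie) ω.1 ω.2 n = A} =
      ⋃ p ∈ {p : List (Finset (Fin k)) × Finset (Fin k) × (Fin k → Fin k → Prop) |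
        greedy M (sortedArms (tie p.1) p.2.1 p.2.2) = A},
      ({ω | (history (interleavedUCB M d tie) ω.1 ω.2 n).map Prod.fst = p.1} ∩
        ({ω | sampled d ω.1 (n + 1) = p.2.1} ∩
        {ω | ∀ i j, (ucbIndex (history (interleavedUCB M d tie) ω.1 ω.2 n) j ≤
          ucbIndex (history (interleavedUCB M d tie) ω.1 ω.2 n) i) ↔ p.2.2 i j})) := by
    ext ω
    simp only [play, interleavedUCB_eq, length_history, Set.mem_ofPred_eq, Set.mem_iUnion,
      Set.mem_inter_iff, exists_prop, Prod.exists]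
    constructor
    · intro h
      exact ⟨_, _, _, h, rfl, rfl, fun _ _ => Iff.rfl⟩
    · rintro ⟨L, G, R, h, hL, hG, hR⟩
      have hR' : (fun i j => ucbIndex (history (interleavedUCB M d tie) ω.1 ω.2 n) j ≤
          ucbIndex (history (interleavedUCB M d tie) ω.1 ω.2 n) i) = R := by
        ext i j; exact hR i j
      rw [hL, hG, hR']
      exact h
  rw [hset]
  refine MeasurableSet.biUnion (Set.to_countable _) fun p _ => ?_
  refine (hlist n le_rfl p.1).inter (MeasurableSet.inter ?_ ?_)
  · exact measurable_fst (measurableSet_sampled_eq (n + 1) p.2.1)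
  · simp only [Set.ofPred_forall]
    refine MeasurableSet.iInter fun i => MeasurableSet.iInter fun j => ?_
    have hle := measurableSet_le (measurable_ucbIndex ih j) (measurable_ucbIndex ih i)
    by_cases hp : p.2.2 i j
    · simpa [hp] using hle
    · simp only [hp, iff_false]
      exact hle.compl

lemma interleavedUCB_play_subset (hM : M.E = Set.univ) (r : Fin k → ℝ) (X : ℕ → Fin k → ℝ)
    (n : ℕ) : play (interleavedUCB M d tie) r X n ⊆ sampled d r (n + 1) := by
  unfold play
  rw [interleavedUCB_eq, length_history]
  refine (greedy_subset M hM _).trans ?_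
  rw [toFinset_sortedArms]

lemma isAdmissible_interleavedUCB (hM : M.E = Set.univ) (hd : ∀ i, 0 < d i) :
    IsAdmissible M d (interleavedUCB M d tie) where
  measurable := measurableSet_play_interleavedUCB M d tie
  indep s X n := by
    unfold play
    rw [interleavedUCB_eq]
    exact (greedy_isBasis M hM _).indep
  available s X m n hmn i hn hm := by
    have := sampled_gap hd (Nat.succ_lt_succ hmn)
      (interleavedUCB_play_subset M d tie hM s X m hm)
      (interleavedUCB_play_subset M d tie hM s X n hn)
    omega

end Admissible

/-! ### The regret of the algorithm -/

section Regret

variable {k : ℕ}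

/-- A bound on the regret caused by playing arm `i` after `n` rounds. -/
noncomputable def armRegret {S : Type} (π : Policy k S) (i : Fin k) (n : ℕ)
    (ω : S × (ℕ → Fin k → ℝ)) : ℝ :=
  if playCount π i n ω = 0 then 1
  else 2 * Real.sqrt (2 * Real.log ((n + 1 : ℕ) : ℝ) / playCount π i n ω)

lemma armRegret_nonneg {S : Type} (π : Policy k S) (i : Fin k) (n : ℕ)
    (ω : S × (ℕ → Fin k → ℝ)) : 0 ≤ armRegret π i n ω := by
  unfold armRegret
  split_ifs <;> positivity

lemma one_div_sqrt_le {N : ℕ} (hN : 0 < N) :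
    1 / Real.sqrt N ≤ 3 * (Real.sqrt ((N + 1 : ℕ) : ℝ) - Real.sqrt N) := by
  have hN' : (1 : ℝ) ≤ N := by exact_mod_cast hN
  set a := Real.sqrt N
  set b := Real.sqrt ((N + 1 : ℕ) : ℝ)
  have ha : 0 < a := Real.sqrt_pos.2 (by linarith)
  have hb : 0 ≤ b := Real.sqrt_nonneg _
  have ha2 : a ^ 2 = N := Real.sq_sqrt (by linarith)
  have hb2 : b ^ 2 = N + 1 := by
    have := Real.sq_sqrt (Nat.cast_nonneg (α := ℝ) (N + 1)); push_cast at this ⊢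
    simpa [b] using this
  -- The constant `3`: then `1 = (b - a) * (b + a) ≤ 3 * a * (b - a)`.
  have hb2a : b ≤ 2 * a := by nlinarith
  have hprod : (b - a) * (b + a) = 1 := by nlinarith
  have hba : 0 ≤ b - a := by
    by_contra h
    nlinarith
  rw [div_le_iff₀ ha]
  nlinarith

/-- The first play costs `1`; the later widths telescope through `one_div_sqrt_le`, whence `6 = 2 *
3`. -/
lemma sum_armRegret_le {S : Type} (π : Policy k S) (i : Fin k) (ω : S × (ℕ → Fin k → ℝ))
    {T n : ℕ} (hn : n ≤ T) :
    ∑ m ∈ Finset.range n, (if i ∈ play π ω.1 ω.2 m then armRegret π i m ω else 0) ≤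
      if playCount π i n ω = 0 then 0
      else 1 + 6 * Real.sqrt (2 * Real.log (T : ℝ)) * Real.sqrt (playCount π i n ω) := by
  induction n with
  | zero => simp [playCount]
  | succ n ih =>
    have hc : playCount π i (n + 1) ω = playCount π i n ω +
        if i ∈ play π ω.1 ω.2 n then 1 else 0 := by
      rw [playCount, Finset.sum_range_succ, ← playCount]
    have ih' := ih (Nat.le_of_succ_le hn)
    rw [Finset.sum_range_succ, hc]
    by_cases hp : i ∈ play π ω.1 ω.2 n
    · simp only [if_pos hp]
      rw [if_neg (Nat.succ_ne_zero _)]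
      by_cases h0 : playCount π i n ω = 0
      · rw [if_pos h0] at ih'
        rw [armRegret, if_pos h0]
        have : 0 ≤ 6 * Real.sqrt (2 * Real.log (T : ℝ)) *
          Real.sqrt ((playCount π i n ω + 1 : ℕ) : ℝ) := by positivity
        linarith
      · rw [if_neg h0] at ih'
        rw [armRegret, if_neg h0]
        have hlog : Real.log ((n + 1 : ℕ) : ℝ) ≤ Real.log (T : ℝ) :=
          Real.log_le_log (by positivity) (by exact_mod_cast hn)
        have hstep : Real.sqrt (2 * Real.log ((n + 1 : ℕ) : ℝ) / playCount π i n ω) ≤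
            Real.sqrt (2 * Real.log (T : ℝ)) * (1 / Real.sqrt (playCount π i n ω)) := by
          rw [mul_one_div, ← Real.sqrt_div' _ (Nat.cast_nonneg _)]
          gcongr
        have h1 := mul_le_mul_of_nonneg_left (one_div_sqrt_le (Nat.pos_of_ne_zero h0))
          (Real.sqrt_nonneg (2 * Real.log (T : ℝ)))
        linarith
    · simpa only [if_neg hp, add_zero] using ih'

lemma sum_armRegret_le' {S : Type} (π : Policy k S) (i : Fin k) (ω : S × (ℕ → Fin k → ℝ))
    (T : ℕ) :
    ∑ m ∈ Finset.range T, (if i ∈ play π ω.1 ω.2 m then armRegret π i m ω else 0) ≤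
      1 + 9 * Real.sqrt (T * Real.log T) := by
  refine (sum_armRegret_le π i ω le_rfl).trans ?_
  have hs : 0 ≤ Real.sqrt ((T : ℝ) * Real.log T) := Real.sqrt_nonneg _
  split_ifs with h
  · linarith
  · have hL : 0 ≤ Real.log (T : ℝ) := Real.log_natCast_nonneg T
    have h2 : Real.sqrt 2 ≤ 3 / 2 := by
      rw [Real.sqrt_le_left (by norm_num)]; norm_num
    have hle : Real.sqrt (playCount π i T ω) ≤ Real.sqrt T :=
      Real.sqrt_le_sqrt (by exact_mod_cast playCount_le π i T ω)
    rw [Real.sqrt_mul (Nat.cast_nonneg T), Real.sqrt_mul zero_le_two]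
    have : 6 * (Real.sqrt 2 * Real.sqrt (Real.log T)) * Real.sqrt (playCount π i T ω) ≤
        6 * (3 / 2 * Real.sqrt (Real.log T)) * Real.sqrt T := by gcongr
    linarith

lemma sum_one_div_cube_le (T : ℕ) :
    ∑ n ∈ Finset.range T, 1 / ((n : ℝ) + 1) ^ 3 ≤ 3 - 2 / ((T : ℝ) + 1) := by
  induction T with
  | zero => norm_num
  | succ T ih =>
    rw [Finset.sum_range_succ]
    have hT : (0 : ℝ) ≤ T := Nat.cast_nonneg T
    -- Telescoping; the subtracted term in the statement is what closes the induction.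
    have h : 1 / ((T : ℝ) + 1) ^ 3 ≤ 2 / ((T : ℝ) + 1) - 2 / (((T + 1 : ℕ) : ℝ) + 1) := by
      push_cast
      rw [div_sub_div _ _ (by positivity) (by positivity), div_le_div_iff₀ (by positivity)
        (by positivity)]
      have h3 : 0 ≤ (T : ℝ) ^ 3 := by positivity
      have h2 : 0 ≤ (T : ℝ) ^ 2 := by positivity
      nlinarith
    linarith

variable (M : Matroid (Fin k)) (d : Fin k → ℕ)
  (tie : List (Finset (Fin k)) → Equiv.Perm (Fin k))

lemma weightedRank_sampled_le_of_notMem (hM : M.E = Set.univ) {μ : Fin k → ℝ}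
    (hμ : ∀ i, μ i ∈ Set.Icc (0 : ℝ) 1) (ω : (Fin k → ℝ) × (ℕ → Fin k → ℝ)) (n : ℕ)
    (hω : ω ∉ deviationEvent (interleavedUCB M d tie) μ n) :
    weightedRank M μ (sampled d ω.1 (n + 1)) ≤
      ∑ i ∈ play (interleavedUCB M d tie) ω.1 ω.2 n,
        (μ i + armRegret (interleavedUCB M d tie) i n ω) := by
  set π := interleavedUCB M d tie with hπ
  set h := history π ω.1 ω.2 n with hh
  set N : Fin k → ℕ := fun i => playCount π i n ω with hN
  set rad : Fin k → ℝ := fun i => Real.sqrt (2 * Real.log ((n + 1 : ℕ) : ℝ) / N i) with hrad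
  have hucb : ∀ i, ucbIndex h i =
      if N i = 0 then ⊤ else ((empMean h i + rad i : ℝ) : EReal) := by
    intro i
    simp only [ucbIndex, hh, pulls_history, length_history, hN, hrad]
  have hgood : ∀ i, N i ≠ 0 → |empMean h i - μ i| ≤ rad i := by
    intro i hi
    have hpos : 0 < N i := Nat.pos_of_ne_zero hi
    have hpos' : (0 : ℝ) < N i := by exact_mod_cast hpos
    have hdev : |deviation π (μ i) i n ω| ≤
        Real.sqrt (2 * N i * Real.log ((n + 1 : ℕ) : ℝ)) := by
      by_contra hc
      exact hω ⟨i, hpos, not_le.1 hc⟩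
    have h1 : empMean h i - μ i = deviation π (μ i) i n ω / N i := by
      rw [hh, empMean_history, deviation_zero_eq π (μ i)]
      change (deviation π (μ i) i n ω + N i * μ i) / N i - μ i = deviation π (μ i) i n ω / N i
      field_simp
      ring
    rw [h1, abs_div, abs_of_pos hpos', div_le_iff₀ hpos']
    refine hdev.trans (le_of_eq ?_)
    have h2 : (N i : ℝ) = Real.sqrt ((N i : ℝ) ^ 2) := (Real.sqrt_sq hpos'.le).symm
    rw [hrad]
    dsimp only
    nth_rewrite 3 [h2]
    rw [← Real.sqrt_mul' _ (by positivity)]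
    congr 1
    field_simp
  -- The index truncated at `1`, to have weights in `[0, 1]`. Truncation is monotone, so a list
  -- sorted by index is sorted by `w`, and on the good event `w` lies between `μ` and `μ` plus the
  -- arm regret.
  set w : Fin k → ℝ := fun i => if N i = 0 then 1 else min 1 (empMean h i + rad i) with hw
  have hμw : ∀ i, μ i ≤ w i := by
    intro i
    simp only [hw]
    split_ifs with h0
    · exact (hμ i).2
    · refine le_min (hμ i).2 ?_
      have := (abs_le.1 (hgood i h0)).1
      linarith
  have hwI : ∀ i, w i ∈ Set.Icc (0 : ℝ) 1 := by
    intro i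
    refine ⟨(hμ i).1.trans (hμw i), ?_⟩
    simp only [hw]
    split_ifs
    · exact le_rfl
    · exact min_le_left _ _
  have hwb : ∀ i, w i ≤ μ i + armRegret π i n ω := by
    intro i
    simp only [hw, armRegret]
    split_ifs with h0
    · linarith [(hμ i).1]
    · have h1 := (abs_le.1 (hgood i h0)).2
      have h2 := min_le_right 1 (empMean h i + rad i)
      change min 1 (empMean h i + rad i) ≤ μ i + 2 * rad i
      linarith
  have hmono : ∀ i j, ucbIndex h j ≤ ucbIndex h i → w j ≤ w i := by
    intro i j hij
    rw [hucb, hucb] at hij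
    simp only [hw]
    by_cases hi : N i = 0
    · rw [if_pos hi]
      exact (hwI j).2
    · rw [if_neg hi] at hij ⊢
      by_cases hj : N j = 0
      · rw [if_pos hj, top_le_iff] at hij
        exact absurd hij (EReal.coe_ne_top _)
      · rw [if_neg hj] at hij ⊢
        exact min_le_min_left 1 (EReal.coe_le_coe_iff.1 hij)
  have hplay : play π ω.1 ω.2 n = greedy M (sortedArms (tie (h.map Prod.fst))
      (sampled d ω.1 (n + 1)) (fun i j => ucbIndex h j ≤ ucbIndex h i)) := by
    rw [play, ← hh, hπ, interleavedUCB_eq, hh, length_history]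
  set l := sortedArms (tie (h.map Prod.fst)) (sampled d ω.1 (n + 1))
    (fun i j => ucbIndex h j ≤ ucbIndex h i) with hl
  have hsorted : l.Pairwise (fun i j => w j ≤ w i) := by
    have : Std.Total (fun i j => ucbIndex h j ≤ ucbIndex h i) :=
      ⟨fun i j => le_total _ _⟩
    have : IsTrans (Fin k) (fun i j => ucbIndex h j ≤ ucbIndex h i) :=
      ⟨fun i j m h1 h2 => le_trans h2 h1⟩
    exact List.Pairwise.imp (fun {i j} => hmono i j) (pairwise_sortedArms _ _ _)
  have hmain := weightedRank_le_sum_greedy M hM hwI hμw l hsorted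
  rw [hl, toFinset_sortedArms, ← hl, ← hplay] at hmain
  exact hmain.trans (Finset.sum_le_sum fun i _ => hwb i)

/-- On the bad event the weighted rank is bounded crudely by `k`. -/
lemma weightedRank_sampled_le (hM : M.E = Set.univ) {μ : Fin k → ℝ}
    (hμ : ∀ i, μ i ∈ Set.Icc (0 : ℝ) 1) (ω : (Fin k → ℝ) × (ℕ → Fin k → ℝ)) (n : ℕ) :
    weightedRank M μ (sampled d ω.1 (n + 1)) ≤
      ∑ i ∈ play (interleavedUCB M d tie) ω.1 ω.2 n, μ i +
      ∑ i ∈ play (interleavedUCB M d tie) ω.1 ω.2 n,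
        armRegret (interleavedUCB M d tie) i n ω +
      (deviationEvent (interleavedUCB M d tie) μ n).indicator (fun _ => (k : ℝ)) ω := by
  by_cases hω : ω ∈ deviationEvent (interleavedUCB M d tie) μ n
  · rw [Set.indicator_of_mem hω]
    have h1 := weightedRank_le_card M μ (sampled d ω.1 (n + 1))
    have h2 : ((sampled d ω.1 (n + 1)).card : ℝ) ≤ k := by
      exact_mod_cast (Finset.card_le_univ _).trans (by simp)
    have h3 : 0 ≤ ∑ i ∈ play (interleavedUCB M d tie) ω.1 ω.2 n, μ i :=
      Finset.sum_nonneg fun i _ => (hμ i).1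
    have h4 : 0 ≤ ∑ i ∈ play (interleavedUCB M d tie) ω.1 ω.2 n,
        armRegret (interleavedUCB M d tie) i n ω :=
      Finset.sum_nonneg fun i _ => armRegret_nonneg _ i n ω
    linarith
  · rw [Set.indicator_of_notMem hω, add_zero, ← Finset.sum_add_distrib]
    exact weightedRank_sampled_le_of_notMem M d tie hM hμ ω n hω

lemma sum_weightedRank_sampled_le (hM : M.E = Set.univ) {μ : Fin k → ℝ}
    (hμ : ∀ i, μ i ∈ Set.Icc (0 : ℝ) 1) (ω : (Fin k → ℝ) × (ℕ → Fin k → ℝ)) (T : ℕ) :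
    ∑ n ∈ Finset.range T, weightedRank M μ (sampled d ω.1 (n + 1)) ≤
      ∑ n ∈ Finset.range T, (∑ i ∈ play (interleavedUCB M d tie) ω.1 ω.2 n, μ i +
        (deviationEvent (interleavedUCB M d tie) μ n).indicator (fun _ => (k : ℝ)) ω) +
      k * (1 + 9 * Real.sqrt (T * Real.log T)) := by
  have h1 := Finset.sum_le_sum fun n (_ : n ∈ Finset.range T) =>
    weightedRank_sampled_le M d tie hM hμ ω n
  have h2 : ∑ n ∈ Finset.range T, ∑ i ∈ play (interleavedUCB M d tie) ω.1 ω.2 n,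
      armRegret (interleavedUCB M d tie) i n ω ≤ k * (1 + 9 * Real.sqrt (T * Real.log T)) := by
    have : ∀ n, ∑ i ∈ play (interleavedUCB M d tie) ω.1 ω.2 n,
        armRegret (interleavedUCB M d tie) i n ω =
        ∑ i, if i ∈ play (interleavedUCB M d tie) ω.1 ω.2 n then
          armRegret (interleavedUCB M d tie) i n ω else 0 := by
      intro n; rw [Finset.sum_ite_mem, Finset.univ_inter]
    simp_rw [this]
    rw [Finset.sum_comm]
    refine (Finset.sum_le_sum fun i _ => sum_armRegret_le' _ i ω T).trans ?_
    rw [Finset.sum_const, Finset.card_univ, Fintype.card_fin, nsmul_eq_mul]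
  simp only [Finset.sum_add_distrib] at h1 ⊢
  linarith

variable {ν : Measure (Fin k → ℝ)} [IsProbabilityMeasure ν]

lemma multilinearExt_le_expectedReward (hM : M.E = Set.univ) (hd : ∀ i, 0 < d i)
    (hν : ∀ᵐ x ∂ν, ∀ i, x i ∈ Set.Icc (0 : ℝ) 1) (T : ℕ) :
    T * multilinearExt (weightedRank M (meanReward ν)) (fun i => 1 / (d i : ℝ)) ≤
      expectedReward (offsetLaw k) ν (interleavedUCB M d tie) T +
        6 * (k : ℝ) ^ 2 + k * (1 + 9 * Real.sqrt (T * Real.log T)) := by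
  set μ := meanReward ν
  set π := interleavedUCB M d tie
  have hμ : ∀ i, μ i ∈ Set.Icc (0 : ℝ) 1 := meanReward_mem_Icc hν
  have hπ := measurableSet_play_interleavedUCB M d tie
  set P := jointLaw (offsetLaw k) ν with hP
  have hs := fun n => integrable_and_integral_sampled hd (n + 1) (weightedRank M μ)
  have hsi : ∀ n, Integrable (fun ω : (Fin k → ℝ) × (ℕ → Fin k → ℝ) =>
      weightedRank M μ (sampled d ω.1 (n + 1))) P := fun n => (hs n).1.comp_fst _
  have hsI : ∀ n, ∫ ω, weightedRank M μ (sampled d ω.1 (n + 1)) ∂P =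
      multilinearExt (weightedRank M μ) (fun i => 1 / (d i : ℝ)) := by
    intro n
    rw [hP, integral_fun_fst (fun r => weightedRank M μ (sampled d r (n + 1))), (hs n).2]
    simp
  have hmi : ∀ n, Integrable (fun ω : (Fin k → ℝ) × (ℕ → Fin k → ℝ) =>
      ∑ i ∈ play π ω.1 ω.2 n, μ i) P := fun n => integrable_sum_means hπ n μ
  have hbi : ∀ n, Integrable ((deviationEvent π μ n).indicator (fun _ => (k : ℝ))) P := fun n =>
    (integrable_const _).indicator (measurableSet_deviationEvent hπ μ n)
  have hbI : ∀ n, ∫ ω, (deviationEvent π μ n).indicator (fun _ => (k : ℝ)) ω ∂P ≤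
      2 * (k : ℝ) ^ 2 * (1 / ((n : ℝ) + 1) ^ 3) := by
    intro n
    rw [integral_indicator_const _ (measurableSet_deviationEvent hπ μ n), smul_eq_mul]
    have h := measure_deviationEvent_le (ρ := offsetLaw k) hν hπ n
    have hk : (0 : ℝ) ≤ k := Nat.cast_nonneg k
    calc P.real (deviationEvent π μ n) * k ≤ 2 * k * (1 / ((n : ℝ) + 1) ^ 3) * k :=
          mul_le_mul_of_nonneg_right h hk
      _ = _ := by ring
  have hmbi : ∀ n ∈ Finset.range T, Integrable (fun ω => ∑ i ∈ play π ω.1 ω.2 n, μ i +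
      (deviationEvent π μ n).indicator (fun _ => (k : ℝ)) ω) P :=
    fun n _ => (hmi n).add (hbi n)
  have hint := integral_mono
    (integrable_finsetSum (Finset.range T) fun n _ => hsi n)
    ((integrable_finsetSum _ hmbi).add
      (integrable_const (k * (1 + 9 * Real.sqrt (T * Real.log T)))))
    (fun ω => sum_weightedRank_sampled_le M d tie hM hμ ω T)
  rw [integral_finsetSum _ fun n _ => hsi n] at hint
  simp only [Pi.add_apply] at hint
  rw [integral_add (integrable_finsetSum _ hmbi) (integrable_const _),
    integral_finsetSum _ hmbi] at hint
  simp only [hsI] at hint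
  rw [Finset.sum_congr rfl fun n _ => integral_add (hmi n) (hbi n), Finset.sum_add_distrib,
    ← expectedReward_eq hν hπ T] at hint
  -- Each bad event costs `k` with probability at most `2 * k / (n + 1) ^ 3`, and the inverse cubes
  -- sum to at most `3`.
  have hb : ∑ n ∈ Finset.range T,
      ∫ ω, (deviationEvent π μ n).indicator (fun _ => (k : ℝ)) ω ∂P ≤ 6 * (k : ℝ) ^ 2 := by
    refine (Finset.sum_le_sum fun n _ => hbI n).trans ?_
    rw [← Finset.mul_sum]
    have h1 := sum_one_div_cube_le T
    have h2 : 0 ≤ 2 / ((T : ℝ) + 1) := by positivity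
    have h3 : 0 ≤ (k : ℝ) ^ 2 := by positivity
    nlinarith
  simp only [Finset.sum_const, Finset.card_range, nsmul_eq_mul, integral_const,
    probReal_univ, smul_eq_mul, one_mul] at hint
  linarith

lemma expectedReward_le_multilinearExt {S : Type} [MeasurableSpace S] {ρ : Measure S}
    [IsProbabilityMeasure ρ] {π : Policy k S} (hπ : IsAdmissible M d π) (hd : ∀ i, 0 < d i)
    (hν : ∀ᵐ x ∂ν, ∀ i, x i ∈ Set.Icc (0 : ℝ) 1) (T : ℕ) :
    (1 - 1 / Real.exp 1) * expectedReward ρ ν π T ≤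
      T * multilinearExt (weightedRank M (meanReward ν)) (fun i => 1 / (d i : ℝ)) + k := by
  have hmi : ∀ n ∈ Finset.range T, Integrable (fun ω : S × (ℕ → Fin k → ℝ) =>
      ∑ i ∈ play π ω.1 ω.2 n, meanReward ν i) (jointLaw ρ ν) :=
    fun n _ => integrable_sum_means hπ.measurable n _
  rw [expectedReward_eq hν hπ.measurable, ← integral_finsetSum _ hmi, ← integral_const_mul]
  have h := integral_mono (μ := jointLaw ρ ν)
    ((integrable_finsetSum _ hmi).const_mul (1 - 1 / Real.exp 1))
    (integrable_const _)
    (fun ω => sum_means_le hd (meanReward_mem_Icc hν) (play π ω.1 ω.2) (hπ.indep ω.1 ω.2)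
      (hπ.available ω.1 ω.2) T)
  refine h.trans (le_of_eq ?_)
  simp

lemma one_sub_inv_exp_one_pos : 0 < 1 - 1 / Real.exp 1 := by
  have h1 : 1 < Real.exp 1 := Real.one_lt_exp_iff.2 one_pos
  rw [sub_pos, div_lt_one (Real.exp_pos 1)]
  exact h1

lemma OPT_le_multilinearExt (hM : M.E = Set.univ) (hd : ∀ i, 0 < d i)
    (hν : ∀ᵐ x ∂ν, ∀ i, x i ∈ Set.Icc (0 : ℝ) 1) (T : ℕ) :
    (1 - 1 / Real.exp 1) * OPT M d ν T ≤
      T * multilinearExt (weightedRank M (meanReward ν)) (fun i => 1 / (d i : ℝ)) + k := by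
  rw [← le_div_iff₀' one_sub_inv_exp_one_pos]
  -- The supremum needs a nonempty set; the algorithm itself, with a trivial tie rule, is an
  -- admissible witness.
  refine csSup_le ⟨_, Fin k → ℝ, inferInstance, offsetLaw k, inferInstance,
    interleavedUCB M d (fun _ => 1), isAdmissible_interleavedUCB M d _ hM hd, rfl⟩ ?_
  rintro x ⟨S, _, ρ, _, π, hπ, rfl⟩
  rw [le_div_iff₀' one_sub_inv_exp_one_pos]
  exact expectedReward_le_multilinearExt M d hπ hd hν T

end Regret

end MatroidBlockingBandits

open MatroidBlockingBandits in
theorem theorem2 :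
    ∃ C : ℝ, 0 < C ∧
      ∀ (k : ℕ) (M : Matroid (Fin k)) (_ : M.E = Set.univ)
        (d : Fin k → ℕ) (_ : ∀ i, 0 < d i)
        (ν : Measure (Fin k → ℝ)) [IsProbabilityMeasure ν]
        (_ : ∀ᵐ x ∂ν, ∀ i, x i ∈ Set.Icc (0 : ℝ) 1)
        (tie : List (Finset (Fin k)) → Equiv.Perm (Fin k)) (T : ℕ),
        IsAdmissible M d (interleavedUCB M d tie) ∧
        (1 - 1 / Real.exp 1) * OPT M d ν T
            - C * ((k : ℝ) * Real.sqrt ((T : ℝ) * Real.log (T : ℝ)) + (k : ℝ) ^ 2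
                + ((Finset.univ.sup d : ℕ) : ℝ) * (M.eRank.toNat : ℝ))
          ≤ expectedReward (offsetLaw k) ν (interleavedUCB M d tie) T := by
  -- The total loss is `9 * k * √(T ln T) + 6 * k ^ 2 + 2 * k`, and `k ≤ k ^ 2`; of the delay-rank
  -- term only nonnegativity is used.
  refine ⟨9, by norm_num, fun k M hM d hd ν _ hν tie T =>
    ⟨isAdmissible_interleavedUCB M d tie hM hd, ?_⟩⟩
  have h1 := OPT_le_multilinearExt M d hM hd hν T
  have h2 := multilinearExt_le_expectedReward M d tie hM hd hν T
  have h3 : (0 : ℝ) ≤ ((Finset.univ.sup d : ℕ) : ℝ) * (M.eRank.toNat : ℝ) := by positivity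
  have h4 : (k : ℝ) ≤ (k : ℝ) ^ 2 := by exact_mod_cast Nat.le_self_pow two_ne_zero k
  linarith
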